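/- Let $S$ be a locally compact Hausdorff topological $*$-semigroup: a semigroup with a jointly continuous product and a continuous involution satisfying $(xy)^*=y^*x^*$, $x^{**}=x$. Let $M(S)$ be the space of bounded regular complex Borel measures on $S$ with the total variation norm, the convolution $\int f\,d(\mu*\nu)=\int\!\int f(xy)\,d\mu(x)\,d\nu(y)$ $(f\in C_0(S))$ and the involution $\mu^*(A)=\overline{\mu(A^*)}$, and let $L(S)$ be the $*$-subalgebra of all $\mu\in M(S)$ for which $x\mapsto|\mu|*\delta_x$ and $x\mapsto\delta_x*|\mu|$ are continuous from $S$ to $M(S)$ with its weak topology. Let $\Sigma$ be the family of all $*$-representations $\pi$ of $S$ on Hilbert spaces $H_\pi$ with $\|\pi(x)\|\le 1$ for all $x\in S$ and with $x\mapsto\langle\pi(x)\xi,\eta\rangle$ continuous for all $\xi,\eta\in H_\pi$. For $\pi\in\Sigma$ and $\mu\in M(S)$ let $\tilde\pi(\mu)$ be the operator on $H_\pi$ with $\langle\tilde\pi(\mu)\xi,\eta\rangle=\int_S\langle\pi(x)\xi,\eta\rangle\,d\mu(x)$. For $\rho\subseteq\Sigma$ put $\|\mu\|_\rho=\sup_{\pi\in\rho}\|\tilde\pi(\mu)\|$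 (which is $0$ if $\rho=\emptyset$) and $N_\rho=\{\mu\in L(S):\|\mu\|_\rho=0\}$, and let the $C^*$-algebra $C^*_\rho(S)$ be the completion of $L(S)/N_\rho$ in the norm $\|\mu+N_\rho\|=\|\mu\|_\rho$. Put $C^*(S)=C^*_\Sigma(S)$ and let $\iota:L(S)\to C^*(S)$ be the canonical map. Each $\tilde\pi$ $(\pi\in\Sigma)$ extends to a $*$-representation of $C^*(S)$, again written $\tilde\pi$, with $\tilde\pi(\iota(\mu))=\tilde\pi(\mu)$. For $\rho\subseteq\Sigma$ let $$N'_\rho=\bigcap_{\pi\in\rho}\ker\tilde\pi\subseteq C^*(S).$$ Then $\iota(N_\rho)\subseteq N'_\rho$, and there is a continuous surjective $*$-homomorphism $\varphi:C^*(S)\to C^*_\rho(S)$ with $\varphi(\iota(\mu))=\mu+N_\rho$ for all $\mu\in L(S)$ and with kernel $N'_\rho$. It is the only $*$-homomorphism, and also the only continuous map, from $C^*(S)$ to $C^*_\rho(S)$ that extends $\mu\mapsto\mu+N_\rho$ in this sense. The map $g+N'_\rho\mapsto\varphi(g)$ is an isometric isomorphism from $C^*(S)/N'_\rho$ with the quotient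 norm onto $C^*_\rho(S)$. -/

import Mathlib

open MeasureTheory Filter Topology
open scoped ENNReal NNReal CompactlySupported ZeroAtInfty ComplexConjugate

noncomputable section

namespace FoundationSemigroup

section Measures

variable {X : Type*} [MeasurableSpace X]

/-- The integral of a complex function against a complex measure. -/
def cint (μ : ComplexMeasure X) (f : X → ℂ) : ℂ :=
  μ.integral f (ContinuousLinearMap.mul ℝ ℂ)

/-- A finite positive measure, seen as a complex measure. -/
def toC (n : Measure X) [IsFiniteMeasure n] : ComplexMeasure X :=
  n.toSignedMeasure.toComplexMeasure 0

theorem toC_apply (n : Measure X) [IsFiniteMeasure n] {A : Set X} (hA : MeasurableSet A) :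
    toC n A = (n.real A : ℂ) := by
  apply Complex.ext <;>
    simp [toC, SignedMeasure.toComplexMeasure_apply, Measure.toSignedMeasure_apply_measurable hA]

theorem toC_add (m n : Measure X) [IsFiniteMeasure m] [IsFiniteMeasure n] :
    toC (m + n) = toC m + toC n := by
  ext A hA
  simp [toC_apply _ hA, measureReal_add_apply]

theorem variation_toC (n : Measure X) [IsFiniteMeasure n] : (toC n).variation = n := by
  have h0 : ∀ A, MeasurableSet A → ‖toC n A‖ₑ = n A := by
    intro A hA
    rw [toC_apply n hA, ← ofReal_norm, Complex.norm_real, Real.norm_of_nonneg measureReal_nonneg,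
      ofReal_measureReal]
  refine le_antisymm (VectorMeasure.variation_le_of_forall_enorm_le fun A hA => (h0 A hA).le) ?_
  refine Measure.le_intro fun A hA _ => ?_
  rw [← h0 A hA]
  exact VectorMeasure.enorm_measure_le_variation _ _

instance finite_variation (μ : ComplexMeasure X) : IsFiniteMeasure μ.variation := by
  have h : μ.variation ≤ (ComplexMeasure.re μ).totalVariation
      + (ComplexMeasure.im μ).totalVariation := by
    refine VectorMeasure.variation_le_of_forall_enorm_le fun A hA => ?_
    rw [Measure.add_apply]
    refine le_trans ?_ (add_le_add (SignedMeasure.enorm_le_totalVariation _ A)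
      (SignedMeasure.enorm_le_totalVariation _ A))
    rw [← ofReal_norm, ← ofReal_norm, ← ofReal_norm,
      ← ENNReal.ofReal_add (norm_nonneg _) (norm_nonneg _)]
    exact ENNReal.ofReal_le_ofReal (Complex.norm_le_abs_re_add_abs_im _)
  exact isFiniteMeasure_of_le _ h

theorem cint_toC (n : Measure X) [IsFiniteMeasure n] (f : X → ℂ) :
    cint (toC n) f = ∫ x, f x ∂n := by
  rw [cint, VectorMeasure.integral_eq_setToFun, MeasureTheory.integral_eq_setToFun]
  simp only [variation_toC]
  apply setToFun_congr_left' _ _ (fun s hs h's ↦ ?_)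
  ext x
  simp [VectorMeasure.transpose, toC_apply n hs, weightedSMul, mul_comm]

theorem cint_add (μ ν : ComplexMeasure X) {f : X → ℂ} (hμ : Integrable f μ.variation)
    (hν : Integrable f ν.variation) : cint (μ + ν) f = cint μ f + cint ν f :=
  VectorMeasure.integral_add_vectorMeasure hμ hν

theorem cint_smul (c : ℂ) (μ : ComplexMeasure X) {f : X → ℂ} (hf : Integrable f μ.variation) :
    cint (c • μ) f = c * cint μ f := by
  have hdom := dominatedFinMeasAdditive_cbmApplyMeasure (c • μ)
    (ContinuousLinearMap.mul ℝ ℂ)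
  have hT : DominatedFinMeasAdditive μ.variation
      ((c • μ).transpose (ContinuousLinearMap.mul ℝ ℂ)) (‖c‖ * ‖ContinuousLinearMap.mul ℝ ℂ‖) := by
    refine ⟨fun s t hs ht _ _ hd => hdom.1 s t hs ht (measure_ne_top _ _) (measure_ne_top _ _) hd,
      fun s hs hsf => ?_⟩
    have := hdom.2 s hs (measure_lt_top _ _)
    rw [VectorMeasure.variation_smul] at this
    simp only [measureReal_def, Measure.smul_apply] at this ⊢
    rw [ENNReal.smul_def, smul_eq_mul, ENNReal.toReal_mul] at this
    simpa [mul_comm, mul_left_comm, mul_assoc] using this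
  have key : ∀ f : X → ℂ, Integrable f μ.variation →
      setToFun μ.variation _ hT f = c * cint μ f := by
    intro f hf
    refine Integrable.induction (fun f => setToFun μ.variation _ hT f = c * cint μ f)
      ?_ ?_ ?_ ?_ hf
    · intro a s hs hμs
      rw [cint, VectorMeasure.integral_eq_setToFun, setToFun_indicator_const _ hs hμs.ne,
        setToFun_indicator_const _ hs hμs.ne]
      simp [VectorMeasure.transpose]
      ring
    · intro f g _ hf hg h1 h2
      rw [setToFun_add hT hf hg, h1, h2, cint, cint, cint, VectorMeasure.integral_add hf hg,
        mul_add]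
    · exact isClosed_eq (continuous_setToFun hT)
        (continuous_const.mul VectorMeasure.continuous_integral)
    · intro f g hfg _ h
      rw [← setToFun_congr_ae hT hfg, h, cint, cint, VectorMeasure.integral_congr_ae hfg]
  rw [← key f hf, cint, VectorMeasure.integral_eq_setToFun]
  refine (setToFun_congr_measure_of_integrable (‖c‖₊ : ℝ≥0∞) (by simp) ?_ hT _ f hf).symm
  rw [VectorMeasure.variation_smul]; rfl

/-- The four positive parts of a complex measure. -/
theorem exists_decomp (μ : ComplexMeasure X) :
    ∃ m : Fin 4 → Measure X, ∃ _ : ∀ i, IsFiniteMeasure (m i), (∀ i, m i ≤ μ.variation) ∧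
      μ = toC (m 0) - toC (m 1) + Complex.I • (toC (m 2) - toC (m 3)) := by
  have hre : (ComplexMeasure.re μ).totalVariation ≤ μ.variation := by
    rw [SignedMeasure.totalVariation_eq_variation]
    refine VectorMeasure.variation_le_of_forall_enorm_le fun A hA =>
      le_trans ?_ (VectorMeasure.enorm_measure_le_variation μ A)
    rw [← ofReal_norm, ← ofReal_norm]
    exact ENNReal.ofReal_le_ofReal (Complex.abs_re_le_norm _)
  have him : (ComplexMeasure.im μ).totalVariation ≤ μ.variation := by
    rw [SignedMeasure.totalVariation_eq_variation]
    refine VectorMeasure.variation_le_of_forall_enorm_le fun A hA =>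
      le_trans ?_ (VectorMeasure.enorm_measure_le_variation μ A)
    rw [← ofReal_norm, ← ofReal_norm]
    exact ENNReal.ofReal_le_ofReal (Complex.abs_im_le_norm _)
  refine ⟨![(ComplexMeasure.re μ).toJordanDecomposition.posPart,
    (ComplexMeasure.re μ).toJordanDecomposition.negPart,
    (ComplexMeasure.im μ).toJordanDecomposition.posPart,
    (ComplexMeasure.im μ).toJordanDecomposition.negPart], ?_, ?_, ?_⟩
  · intro i
    fin_cases i <;> simp <;> infer_instance
  · intro i
    fin_cases i
    · exact le_trans (Measure.le_add_right le_rfl) hre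
    · exact le_trans (Measure.le_add_left le_rfl) hre
    · exact le_trans (Measure.le_add_right le_rfl) him
    · exact le_trans (Measure.le_add_left le_rfl) him
  · ext A hA
    have h1 := (ComplexMeasure.re μ).apply_eq_posPart_real_sub_negPart_real hA
    have h2 := (ComplexMeasure.im μ).apply_eq_posPart_real_sub_negPart_real hA
    have e1 : (ComplexMeasure.re μ) A = (μ A).re := rfl
    have e2 : (ComplexMeasure.im μ) A = (μ A).im := rfl
    rw [e1] at h1
    rw [e2] at h2
    apply Complex.ext
    · simp [toC_apply _ hA, h1]
    · simp [toC_apply _ hA, h2]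

end Measures

section Radon

variable {X : Type*} [MeasurableSpace X] [TopologicalSpace X] [BorelSpace X]
  [T2Space X]

theorem regular_of_ac {m n : Measure X} [IsFiniteMeasure m] [IsFiniteMeasure n] [m.Regular]
    (h : n ≪ m) : n.Regular := by
  have : n.InnerRegularCompactLTTop := by
    refine ⟨fun A hA r hr => ?_⟩
    have hK : ∀ k : ℕ, ∃ K, K ⊆ A ∧ IsCompact K ∧ m (A \ K) < ((k : ℝ≥0∞) + 1)⁻¹ := fun k =>
      hA.1.exists_isCompact_sdiff_lt (measure_ne_top m A) (by simp)
    choose K hKA hKc hKm using hK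
    have hmeas : ∀ k, MeasurableSet (K k) := fun k => (hKc k).measurableSet
    have h0 : m (A \ ⋃ k, K k) = 0 := by
      have hle : ∀ k : ℕ, m (A \ ⋃ k, K k) ≤ ((k : ℝ≥0∞) + 1)⁻¹ := fun k =>
        (measure_mono (Set.sdiff_subset_sdiff_right (Set.subset_iUnion K k))).trans (hKm k).le
      have ht : Tendsto (fun k : ℕ => ((k : ℝ≥0∞) + 1)⁻¹) atTop (𝓝 0) := by
        have := (ENNReal.tendsto_inv_nat_nhds_zero).comp (tendsto_add_atTop_nat 1)
        simpa [Function.comp_def] using this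
      exact le_antisymm (ge_of_tendsto' ht hle) bot_le
    have h1 : n (A \ ⋃ k, K k) = 0 := h h0
    have h2 : n A = n (⋃ k, K k) := by
      refine le_antisymm ?_ (measure_mono (Set.iUnion_subset hKA))
      calc n A ≤ n ((A \ ⋃ k, K k) ∪ ⋃ k, K k) := measure_mono (by simp)
        _ ≤ n (A \ ⋃ k, K k) + n (⋃ k, K k) := measure_union_le _ _
        _ = n (⋃ k, K k) := by rw [h1, zero_add]
    have h3 := tendsto_measure_iUnion_accumulate (μ := n) (f := K)
    rw [← h2] at h3
    obtain ⟨k, hk⟩ := ((tendsto_order.1 h3).1 r hr).exists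
    refine ⟨Set.accumulate K k, ?_, ?_, hk⟩
    · exact Set.iUnion₂_subset fun i _ => hKA i
    · exact (Set.finite_le_nat k).isCompact_biUnion fun i _ => hKc i
  infer_instance

theorem regular_of_le {m n : Measure X} [IsFiniteMeasure m] [m.Regular]
    (h : n ≤ m) : n.Regular := by
  have := isFiniteMeasure_of_le m h
  exact regular_of_ac (Measure.absolutelyContinuous_of_le h)

theorem regular_add {m n : Measure X} [IsFiniteMeasure m] [IsFiniteMeasure n] [m.Regular]
    [n.Regular] : (m + n).Regular := by
  have h1 : m.InnerRegular := inferInstance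
  have h2 : n.InnerRegular := inferInstance
  have h3 : (m + n).InnerRegular := inferInstance
  infer_instance

theorem regular_map {m : Measure X} [IsFiniteMeasure m] [m.Regular] {Y : Type*}
    [MeasurableSpace Y] [TopologicalSpace Y] [BorelSpace Y] [T2Space Y] {g : X → Y}
    (hg : Continuous g) : (m.map g).Regular := by
  have h1 : m.InnerRegular := inferInstance
  have h2 : (m.map g).InnerRegular := h1.map_of_continuous hg
  infer_instance

theorem regular_dirac (x : X) : (Measure.dirac x).Regular := by
  have : (Measure.dirac x).InnerRegularCompactLTTop := by
    refine ⟨fun A hA r hr => ?_⟩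
    by_cases hx : x ∈ A
    · refine ⟨{x}, by simpa using hx, isCompact_singleton, ?_⟩
      rw [Measure.dirac_apply' _ hA.1] at hr
      simpa [hx] using hr
    · rw [Measure.dirac_apply' _ hA.1] at hr
      simp [hx] at hr
  infer_instance

theorem integrable_of_bdd {m : Measure X} [IsFiniteMeasure m] {E : Type*} [NormedAddCommGroup E]
    [SecondCountableTopologyEither X E] {f : X → E} (hf : Continuous f) {C : ℝ}
    (hC : ∀ x, ‖f x‖ ≤ C) : Integrable f m :=
  Integrable.of_bound hf.aestronglyMeasurable C (Eventually.of_forall hC)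

variable [LocallyCompactSpace X]

theorem exists_cutoff (m : Measure X) [IsFiniteMeasure m] [m.Regular] {K₀ : Set X}
    (hK₀ : IsCompact K₀) {ε : ℝ} (hε : 0 < ε) :
    ∃ a : C(X, ℝ), HasCompactSupport a ∧ (∀ x, 0 ≤ a x ∧ a x ≤ 1) ∧ (∀ x ∈ K₀, a x = 1) ∧
      ∫ x, (1 - a x) ∂m ≤ ε := by
  obtain ⟨K, -, hK, hKm⟩ := (MeasurableSet.univ (α := X)).exists_isCompact_sdiff_lt
    (measure_ne_top m Set.univ) (ε := ENNReal.ofReal ε) (by simpa using hε)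
  obtain ⟨a, ha1, -, hac, ha⟩ := exists_continuous_one_zero_of_isCompact (hK.union hK₀)
    (isClosed_empty) (Set.disjoint_empty _)
  refine ⟨a, hac, fun x => ha x, fun x hx => ha1 (Or.inr hx), ?_⟩
  calc ∫ x, (1 - a x) ∂m ≤ ∫ x, (Set.univ \ K).indicator (fun _ => (1 : ℝ)) x ∂m := by
        refine integral_mono ?_ ?_ fun x => ?_
        · exact integrable_of_bdd (C := 1) (by fun_prop) fun x => by
            rw [Real.norm_eq_abs, abs_le]; constructor <;> linarith [(ha x).1, (ha x).2]
        · exact (integrable_const _).indicator (MeasurableSet.univ.diff hK.measurableSet)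
        · by_cases hx : x ∈ K
          · simp [hx, ha1 (Or.inl hx)]
          · simp [hx, (ha x).1]
    _ = m.real (Set.univ \ K) := by
        rw [integral_indicator_const _ (MeasurableSet.univ.diff hK.measurableSet)]; simp
    _ ≤ ε := ENNReal.toReal_le_of_le_ofReal hε.le hKm.le

/-- Integrals of bounded continuous functions depend continuously on a parameter. -/
theorem continuous_param (m : Measure X) [IsFiniteMeasure m] [m.Regular] {Y : Type*}
    [TopologicalSpace Y] {E : Type*} [NormedAddCommGroup E] [NormedSpace ℝ E]
    [SecondCountableTopology E] {H : Y → X → E} (hH : Continuous fun p : Y × X => H p.1 p.2) {C : ℝ}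
    (hC : ∀ y x, ‖H y x‖ ≤ C) : Continuous fun y => ∫ x, H y x ∂m := by
  refine continuous_of_uniform_approx_of_continuous fun u hu => ?_
  obtain ⟨ε, hε, hεu⟩ := Metric.mem_uniformity_dist.1 hu
  have hC0 : 0 ≤ |C| + 1 := by positivity
  obtain ⟨a, hac, ha, -, hai⟩ := exists_cutoff m isCompact_empty
    (ε := ε / 2 / (|C| + 1)) (by positivity)
  have h1 : ∀ y, Integrable (fun x => H y x) m := fun y =>
    integrable_of_bdd (hH.comp (Continuous.prodMk_right y)) (hC y)
  have h2 : ∀ y, Integrable (fun x => a x • H y x) m := fun y =>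
    integrable_of_bdd (C := C) (a.continuous.smul
      (hH.comp (Continuous.prodMk_right y))) fun x => by
        rw [norm_smul, Real.norm_of_nonneg (ha x).1]
        exact (mul_le_of_le_one_left (norm_nonneg _) (ha x).2).trans (hC y x)
  refine ⟨fun y => ∫ x, a x • H y x ∂m, ?_, fun y => hεu ?_⟩
  · rw [← continuousOn_univ]
    refine continuousOn_integral_of_compact_support hac.isCompact ?_ ?_
    · refine Continuous.continuousOn ?_
      exact (a.continuous.comp continuous_snd).smul hH
    · intro p x _ hx
      simp [image_eq_zero_of_notMem_tsupport hx]
  · rw [dist_eq_norm, ← integral_sub (h1 y) (h2 y)]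
    calc ‖∫ x, (H y x - a x • H y x) ∂m‖ ≤ ∫ x, (1 - a x) * (|C| + 1) ∂m := by
          refine norm_integral_le_of_norm_le ?_ (Eventually.of_forall fun x => ?_)
          · refine Integrable.mul_const ?_ _
            exact integrable_of_bdd (C := 1) (by fun_prop) fun x => by
              rw [Real.norm_eq_abs, abs_le]; constructor <;> linarith [(ha x).1, (ha x).2]
          · have : H y x - a x • H y x = (1 - a x) • H y x := by
              rw [sub_smul, one_smul]
            rw [this, norm_smul, Real.norm_of_nonneg (by linarith [(ha x).2])]
            exact mul_le_mul_of_nonneg_left (by linarith [hC y x, le_abs_self C])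
              (by linarith [(ha x).2])
      _ = (∫ x, (1 - a x) ∂m) * (|C| + 1) := integral_mul_const _ _
      _ ≤ ε / 2 / (|C| + 1) * (|C| + 1) := mul_le_mul_of_nonneg_right hai hC0
      _ = ε / 2 := by field_simp
      _ < ε := by linarith


section Fubini

variable {Y : Type*} [MeasurableSpace Y] [TopologicalSpace Y] [BorelSpace Y] [T2Space Y]
  [LocallyCompactSpace Y]

theorem fubini_estimate (m : Measure X) (n : Measure Y) [IsFiniteMeasure m] [m.Regular]
    [IsFiniteMeasure n] [n.Regular] {H : X → Y → ℂ}
    (hH : Continuous fun p : X × Y => H p.1 p.2) {C : ℝ} (hC : ∀ x y, ‖H x y‖ ≤ C)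
    {a : C(X, ℝ)} {b : C(Y, ℝ)} (ha : ∀ x, 0 ≤ a x ∧ a x ≤ 1)
    (hb : ∀ y, 0 ≤ b y ∧ b y ≤ 1) :
    ‖∫ x, ∫ y, H x y ∂n ∂m - ∫ x, ∫ y, (a x * b y) • H x y ∂n ∂m‖ ≤
      C * ((∫ x, (1 - a x) ∂m) * n.real Set.univ + m.real Set.univ * ∫ y, (1 - b y) ∂n) := by
  have ia : Integrable (fun x => 1 - a x) m := integrable_of_bdd (C := 1) (by fun_prop) fun x => by
    rw [Real.norm_eq_abs, abs_le]; constructor <;> linarith [(ha x).1, (ha x).2]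
  have ib : Integrable (fun y => 1 - b y) n := integrable_of_bdd (C := 1) (by fun_prop) fun x => by
    rw [Real.norm_eq_abs, abs_le]; constructor <;> linarith [(hb x).1, (hb x).2]
  have hH' : Continuous fun p : X × Y => (a p.1 * b p.2) • H p.1 p.2 := by fun_prop
  have hC' : ∀ x y, ‖(a x * b y) • H x y‖ ≤ C := fun x y => by
    rw [norm_smul, Real.norm_of_nonneg (mul_nonneg (ha x).1 (hb y).1)]
    exact (mul_le_of_le_one_left (norm_nonneg _)
      (mul_le_one₀ (ha x).2 (hb y).1 (hb y).2)).trans (hC x y)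
  have key : ∀ G : X → Y → ℂ, Continuous (fun p : X × Y => G p.1 p.2) → (∀ x y, ‖G x y‖ ≤ C) →
      Integrable (fun x => ∫ y, G x y ∂n) m := fun G hG hGC =>
    integrable_of_bdd (continuous_param n hG hGC) (C := C * n.real Set.univ) fun x =>
      norm_integral_le_of_norm_le_const (Eventually.of_forall (hGC x))
  have key2 : ∀ G : X → Y → ℂ, Continuous (fun p : X × Y => G p.1 p.2) → (∀ x y, ‖G x y‖ ≤ C) →
      ∀ x, Integrable (fun y => G x y) n := fun G hG hGC x =>
    integrable_of_bdd (hG.comp (Continuous.prodMk_right x)) (hGC x)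
  rw [← integral_sub (key _ hH hC) (key _ hH' hC')]
  have e : ∀ x, ∫ y, H x y ∂n - ∫ y, (a x * b y) • H x y ∂n =
      ∫ y, (H x y - (a x * b y) • H x y) ∂n := fun x =>
    (integral_sub (key2 _ hH hC x) (key2 _ hH' hC' x)).symm
  have inner : ∀ x, ‖∫ y, H x y ∂n - ∫ y, (a x * b y) • H x y ∂n‖ ≤
      C * ((1 - a x) * n.real Set.univ + ∫ y, (1 - b y) ∂n) := by
    intro x
    rw [e x]
    have hint : Integrable (fun y => C * ((1 - a x) + (1 - b y))) n :=
      ((integrable_const _).add ib).const_mul _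
    refine (norm_integral_le_of_norm_le hint (Eventually.of_forall fun y => ?_)).trans_eq ?_
    · have : H x y - (a x * b y) • H x y = (1 - a x * b y) • H x y := by
        rw [sub_smul, one_smul]
      rw [this, norm_smul, Real.norm_of_nonneg
        (by linarith [mul_le_one₀ (ha x).2 (hb y).1 (hb y).2]), mul_comm C]
      refine mul_le_mul ?_ (hC x y) (norm_nonneg _) (by linarith [(ha x).2, (hb y).2])
      nlinarith [(ha x).1, (ha x).2, (hb y).1, (hb y).2]
    · rw [integral_const_mul, integral_add (integrable_const _) ib, integral_const]
      simp [mul_comm]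
  have hint : Integrable (fun x => C * ((1 - a x) * n.real Set.univ + ∫ y, (1 - b y) ∂n)) m :=
    ((ia.mul_const _).add (integrable_const _)).const_mul _
  refine (norm_integral_le_of_norm_le hint (Eventually.of_forall inner)).trans_eq ?_
  rw [integral_const_mul, integral_add (ia.mul_const _) (integrable_const _), integral_mul_const,
    integral_const]
  simp

/-- Fubini for bounded continuous functions and finite regular measures. -/
theorem fubini (m : Measure X) (n : Measure Y) [IsFiniteMeasure m] [m.Regular]
    [IsFiniteMeasure n] [n.Regular] {H : X → Y → ℂ}
    (hH : Continuous fun p : X × Y => H p.1 p.2) {C : ℝ} (hC : ∀ x y, ‖H x y‖ ≤ C) :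
    ∫ x, ∫ y, H x y ∂n ∂m = ∫ y, ∫ x, H x y ∂m ∂n := by
  have hC1 : ∀ x y, ‖H x y‖ ≤ |C| := fun x y => (hC x y).trans (le_abs_self C)
  have hs : Continuous fun p : Y × X => H p.2 p.1 := hH.comp continuous_swap
  rw [← sub_eq_zero, ← norm_le_zero_iff]
  refine le_of_forall_pos_le_add fun ε hε => ?_
  set D := 2 * (|C| + 1) * (m.real Set.univ + n.real Set.univ + 1) with hD
  have hm : 0 ≤ m.real Set.univ := measureReal_nonneg
  have hn : 0 ≤ n.real Set.univ := measureReal_nonneg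
  have hDpos : 0 < D := by positivity
  obtain ⟨a, hac, ha, -, hai⟩ := exists_cutoff m isCompact_empty (ε := ε / D) (by positivity)
  obtain ⟨b, hbc, hb, -, hbi⟩ := exists_cutoff n isCompact_empty (ε := ε / D) (by positivity)
  have h1 := fubini_estimate m n hH hC1 ha hb
  have h2 := fubini_estimate n m hs (fun y x => hC1 x y) hb ha
  have h3 : ∫ x, ∫ y, (a x * b y) • H x y ∂n ∂m = ∫ y, ∫ x, (b y * a x) • H x y ∂m ∂n := by
    simp only [mul_comm (b _) (a _)]
    refine integral_integral_swap_of_hasCompactSupport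
      (f := fun x y => (a x * b y) • H x y) ?_ ?_
    · change Continuous fun p : X × Y => (a p.1 * b p.2) • H p.1 p.2
      fun_prop
    · refine HasCompactSupport.of_support_subset_isCompact (hac.isCompact.prod hbc.isCompact) ?_
      rintro ⟨x, y⟩ hxy
      simp only [Function.mem_support, Function.uncurry_apply_pair, ne_eq, smul_eq_zero,
        mul_eq_zero, not_or] at hxy
      exact ⟨subset_tsupport _ hxy.1.1, subset_tsupport _ hxy.1.2⟩
  rw [h3] at h1
  rw [norm_sub_rev] at h2
  have h4 := (norm_sub_le_norm_sub_add_norm_sub _ _ _).trans (add_le_add h1 h2)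
  refine h4.trans ?_
  have hC0 := abs_nonneg C
  have e0 : 0 < ε / D := by positivity
  have hq : |C| * ((∫ x, (1 - a x) ∂m) * n.real Set.univ +
      m.real Set.univ * ∫ y, (1 - b y) ∂n) ≤ |C| * ((ε / D) * n.real Set.univ
        + m.real Set.univ * (ε / D)) := by gcongr
  have hq2 : |C| * ((∫ x, (1 - b x) ∂n) * m.real Set.univ +
      n.real Set.univ * ∫ y, (1 - a y) ∂m) ≤ |C| * ((ε / D) * m.real Set.univ
        + n.real Set.univ * (ε / D)) := by gcongr
  have hfin : 2 * (|C| * ((ε / D) * (m.real Set.univ + n.real Set.univ))) ≤ ε := by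
    have h5 : D * (ε / D) = ε := by field_simp
    calc 2 * (|C| * ((ε / D) * (m.real Set.univ + n.real Set.univ)))
        = 2 * |C| * (m.real Set.univ + n.real Set.univ) * (ε / D) := by ring
      _ ≤ 2 * (|C| + 1) * (m.real Set.univ + n.real Set.univ + 1) * (ε / D) := by
          refine mul_le_mul_of_nonneg_right ?_ e0.le
          nlinarith
      _ = ε := h5
  linarith

end Fubini

end Radon

section Conv

variable {S : Type*} [Mul S] [TopologicalSpace S] [ContinuousMul S] [T2Space S]
  [LocallyCompactSpace S] [MeasurableSpace S] [BorelSpace S]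

theorem continuous_conv_inner (m : Measure S) [IsFiniteMeasure m] [m.Regular] {E : Type*}
    [NormedAddCommGroup E] [NormedSpace ℝ E] [SecondCountableTopology E] {f : S → E}
    (hf : Continuous f) {C : ℝ} (hC : ∀ x, ‖f x‖ ≤ C) :
    Continuous fun y => ∫ x, f (x * y) ∂m :=
  continuous_param m (H := fun y x => f (x * y))
    (hf.comp (continuous_snd.mul continuous_fst)) fun _ _ => hC _

theorem integrable_conv_inner (m n : Measure S) [IsFiniteMeasure m] [m.Regular]
    [IsFiniteMeasure n] {E : Type*}
    [NormedAddCommGroup E] [NormedSpace ℝ E] [SecondCountableTopology E] {f : S → E}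
    (hf : Continuous f) {C : ℝ} (hC : ∀ x, ‖f x‖ ≤ C) :
    Integrable (fun y => ∫ x, f (x * y) ∂m) n :=
  integrable_of_bdd (continuous_conv_inner m hf hC) (C := C * m.real Set.univ) fun _ =>
      norm_integral_le_of_norm_le_const (Eventually.of_forall fun _ => hC _)

theorem integrable_trans (m : Measure S) [IsFiniteMeasure m] {E : Type*}
    [NormedAddCommGroup E] [SecondCountableTopology E] {f : S → E}
    (hf : Continuous f) {C : ℝ} (hC : ∀ x, ‖f x‖ ≤ C) (y : S) :
    Integrable (fun x => f (x * y)) m :=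
  integrable_of_bdd (hf.comp (continuous_mul_const y)) fun _ => hC _

theorem exists_bound_cc (f : C_c(S, ℝ)) : ∃ C, ∀ x, ‖f x‖ ≤ C :=
  f.hasCompactSupport.exists_bound_of_continuous f.continuous

/-- The positive functional `f ↦ ∫∫ f(xy) dm(x) dn(y)`. -/
def convFunctional (m n : Measure S) [IsFiniteMeasure m] [m.Regular] [IsFiniteMeasure n] :
    C_c(S, ℝ) →ₚ[ℝ] ℝ :=
  PositiveLinearMap.mk₀
    { toFun := fun f => ∫ y, ∫ x, f (x * y) ∂m ∂n
      map_add' := fun f g => by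
        obtain ⟨C, hC⟩ := exists_bound_cc f
        obtain ⟨D, hD⟩ := exists_bound_cc g
        refine Eq.trans ?_ (integral_add (integrable_conv_inner m n f.continuous hC)
          (integrable_conv_inner m n g.continuous hD))
        congr 1 with y
        exact integral_add (integrable_trans m f.continuous hC y)
          (integrable_trans m g.continuous hD y)
      map_smul' := fun c f => by
        simp [integral_const_mul] }
    fun f hf => integral_nonneg fun y => integral_nonneg fun x => hf (x * y)

theorem exists_conv_pos (m n : Measure S) [IsFiniteMeasure m] [m.Regular] [IsFiniteMeasure n]
    [n.Regular] : ∃ k : Measure S, IsFiniteMeasure k ∧ k.Regular ∧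
      k Set.univ ≤ m Set.univ * n Set.univ ∧
      ∀ (f : S → ℂ), Continuous f → (∃ C, ∀ x, ‖f x‖ ≤ C) →
        ∫ z, f z ∂k = ∫ y, ∫ x, f (x * y) ∂m ∂n := by
  set k := RealRMK.rieszMeasure (convFunctional m n) with hk
  have hreg : k.Regular := inferInstance
  have hint : ∀ f : C_c(S, ℝ), ∫ z, f z ∂k = ∫ y, ∫ x, f (x * y) ∂m ∂n := fun f =>
    RealRMK.integral_rieszMeasure (convFunctional m n) f
  have hbound : k Set.univ ≤ m Set.univ * n Set.univ := by
    rw [isOpen_univ.measure_eq_iSup_isCompact]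
    refine iSup₂_le fun K _ => iSup_le fun hK => ?_
    obtain ⟨a, ha1, -, hac, ha⟩ := exists_continuous_one_zero_of_isCompact hK
      (isClosed_empty) (Set.disjoint_empty _)
    let f : C_c(S, ℝ) := ⟨a, hac⟩
    have h1 : k K ≤ ENNReal.ofReal (∫ z, f z ∂k) := by
      rw [ofReal_integral_eq_lintegral_ofReal f.integrable
        (Eventually.of_forall fun x => (ha x).1)]
      rw [← lintegral_indicator_one hK.measurableSet]
      refine lintegral_mono fun x => ?_
      by_cases hx : x ∈ K
      · simp [hx, f, ha1 hx]
      · simp [hx]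
    refine h1.trans ?_
    rw [hint f]
    have h2 : ∫ y, ∫ x, f (x * y) ∂m ∂n ≤ m.real Set.univ * n.real Set.univ := by
      refine (le_abs_self _).trans ?_
      rw [← Real.norm_eq_abs]
      refine norm_integral_le_of_norm_le_const (Eventually.of_forall fun y => ?_)
      rw [← one_mul (m.real Set.univ)]
      refine norm_integral_le_of_norm_le_const (Eventually.of_forall fun x => ?_)
      exact (Real.norm_of_nonneg (ha (x * y)).1).trans_le (ha (x * y)).2
    refine (ENNReal.ofReal_le_ofReal h2).trans_eq ?_
    rw [ENNReal.ofReal_mul measureReal_nonneg, ofReal_measureReal, ofReal_measureReal]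
  have hfin : IsFiniteMeasure k :=
    ⟨hbound.trans_lt (ENNReal.mul_lt_top (measure_lt_top _ _) (measure_lt_top _ _))⟩
  refine ⟨k, hfin, hreg, hbound, ?_⟩
  -- real bounded functions
  have hreal : ∀ (f : S → ℝ), Continuous f → (∃ C, ∀ x, ‖f x‖ ≤ C) →
        ∫ z, f z ∂k = ∫ y, ∫ x, f (x * y) ∂m ∂n := by
    rintro f hf ⟨C, hC⟩
    rw [← sub_eq_zero, ← norm_le_zero_iff]
    refine le_of_forall_pos_le_add fun ε hε => ?_
    set D := (|C| + 1) * (m.real Set.univ + n.real Set.univ + 1) with hD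
    have hm : 0 ≤ m.real Set.univ := measureReal_nonneg
    have hn : 0 ≤ n.real Set.univ := measureReal_nonneg
    have hC0 := abs_nonneg C
    have hDpos : 0 < D := by positivity
    have e0 : 0 < ε / D := by positivity
    obtain ⟨b, hbc, hb, -, hbi⟩ := exists_cutoff m isCompact_empty e0
    obtain ⟨c, hcc, hc, -, hci⟩ := exists_cutoff n isCompact_empty e0
    obtain ⟨a, hac, ha, ha1, hai⟩ := exists_cutoff k
      ((hbc.isCompact.prod hcc.isCompact).image continuous_mul) e0
    have unit : ∀ (g : C(S, ℝ)), (∀ x, 0 ≤ g x ∧ g x ≤ 1) → ∀ x, ‖1 - g x‖ ≤ 1 := fun g hg x => by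
      rw [Real.norm_eq_abs, abs_le]; constructor <;> linarith [(hg x).1, (hg x).2]
    have ib : Integrable (fun x => 1 - b x) m :=
      integrable_of_bdd (C := 1) (by fun_prop) (unit b hb)
    have ic : Integrable (fun x => 1 - c x) n :=
      integrable_of_bdd (C := 1) (by fun_prop) (unit c hc)
    have ia : Integrable (fun x => 1 - a x) k :=
      integrable_of_bdd (C := 1) (by fun_prop) (unit a ha)
    let af : C_c(S, ℝ) := ⟨⟨fun x => a x * f x, a.continuous.mul hf⟩, hac.mul_right⟩
    have hafc : Continuous fun x => af x := a.continuous.mul hf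
    have haf : ∀ x, af x = a x * f x := fun _ => rfl
    have hafC : ∀ x, ‖af x‖ ≤ C := fun x => by
      rw [haf, norm_mul, Real.norm_of_nonneg (ha x).1]
      exact (mul_le_of_le_one_left (norm_nonneg _) (ha x).2).trans (hC x)
    have hdiff : ∀ x, ‖f x - af x‖ ≤ |C| * (1 - a x) := fun x => by
      have : f x - af x = (1 - a x) * f x := by rw [haf]; ring
      rw [this, norm_mul, Real.norm_of_nonneg (by linarith [(ha x).2]), mul_comm]
      exact mul_le_mul_of_nonneg_right ((hC x).trans (le_abs_self C)) (by linarith [(ha x).2])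
    have E1 : ‖∫ z, f z ∂k - ∫ z, af z ∂k‖ ≤ |C| * (ε / D) := by
      rw [← integral_sub (integrable_of_bdd hf hC) (integrable_of_bdd hafc hafC)]
      refine (norm_integral_le_of_norm_le (ia.const_mul |C|)
        (Eventually.of_forall hdiff)).trans ?_
      rw [integral_const_mul]
      exact mul_le_mul_of_nonneg_left hai hC0
    have hprod : ∀ x y, 1 - a (x * y) ≤ (1 - b x) + (1 - c y) := fun x y => by
      by_cases hx : x ∈ tsupport b
      · by_cases hy : y ∈ tsupport c
        · rw [ha1 (x * y) ⟨(x, y), ⟨hx, hy⟩, rfl⟩]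
          linarith [(hb x).2, (hc y).2]
        · rw [image_eq_zero_of_notMem_tsupport hy]
          linarith [(hb x).2, (ha (x * y)).1]
      · rw [image_eq_zero_of_notMem_tsupport hx]
        linarith [(hc y).2, (ha (x * y)).1]
    have E2 : ‖∫ y, ∫ x, f (x * y) ∂m ∂n - ∫ y, ∫ x, af (x * y) ∂m ∂n‖ ≤
        |C| * ((ε / D) * n.real Set.univ + m.real Set.univ * (ε / D)) := by
      rw [← integral_sub (integrable_conv_inner m n hf hC)
        (integrable_conv_inner m n hafc hafC)]
      have inner : ∀ y, ‖∫ x, f (x * y) ∂m - ∫ x, af (x * y) ∂m‖ ≤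
          |C| * (ε / D + m.real Set.univ * (1 - c y)) := fun y => by
        have h3 := integral_sub (integrable_trans m hf hC y)
          (integrable_trans m hafc hafC y)
        refine (congrArg norm h3.symm).trans_le ?_
        refine (norm_integral_le_of_norm_le ((ib.add (integrable_const (1 - c y))).const_mul |C|)
          (Eventually.of_forall fun x => (hdiff (x * y)).trans
            (mul_le_mul_of_nonneg_left (hprod x y) hC0))).trans ?_
        rw [integral_const_mul]
        refine mul_le_mul_of_nonneg_left ?_ hC0
        refine (integral_add ib (integrable_const (1 - c y))).trans_le ?_
        rw [integral_const, smul_eq_mul]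
        linarith
      refine (norm_integral_le_of_norm_le
        (((integrable_const (ε / D)).add (ic.const_mul (m.real Set.univ))).const_mul |C|)
        (Eventually.of_forall inner)).trans ?_
      rw [integral_const_mul]
      refine mul_le_mul_of_nonneg_left ?_ hC0
      refine (integral_add (integrable_const (ε / D)) (ic.const_mul _)).trans_le ?_
      rw [integral_const, smul_eq_mul, integral_const_mul, mul_comm]
      gcongr
    rw [hint af] at E1
    rw [norm_sub_rev] at E2
    refine (norm_sub_le_norm_sub_add_norm_sub _ _ _).trans ((add_le_add E1 E2).trans ?_)
    have h5 : D * (ε / D) = ε := by field_simp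
    calc |C| * (ε / D) + |C| * (ε / D * n.real Set.univ + m.real Set.univ * (ε / D))
        = |C| * (m.real Set.univ + n.real Set.univ + 1) * (ε / D) := by ring
      _ ≤ (|C| + 1) * (m.real Set.univ + n.real Set.univ + 1) * (ε / D) := by
          refine mul_le_mul_of_nonneg_right ?_ e0.le
          nlinarith
      _ = 0 + ε := by rw [zero_add]; exact h5
  rintro f hf ⟨C, hC⟩
  have h1 := hreal (fun z => (f z).re) (Complex.continuous_re.comp hf)
    ⟨C, fun x => (Complex.abs_re_le_norm _).trans (hC x)⟩
  have h2 := hreal (fun z => (f z).im) (Complex.continuous_im.comp hf)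
    ⟨C, fun x => (Complex.abs_im_le_norm _).trans (hC x)⟩
  have e : ∀ y, Integrable (fun x => f (x * y)) m := integrable_trans m hf hC
  apply Complex.ext
  · have := integral_re (𝕜 := ℂ) (integrable_of_bdd (m := k) hf hC)
    have h3 := integral_re (𝕜 := ℂ) (integrable_conv_inner m n hf hC)
    simp only [RCLike.re_eq_complex_re] at this h3
    rw [← this, h1, ← h3]
    congr 1 with y
    have := integral_re (𝕜 := ℂ) (e y)
    simpa using this
  · have := integral_im (𝕜 := ℂ) (integrable_of_bdd (m := k) hf hC)
    have h3 := integral_im (𝕜 := ℂ) (integrable_conv_inner m n hf hC)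
    simp only [RCLike.im_eq_complex_im] at this h3
    rw [← this, h2, ← h3]
    congr 1 with y
    have := integral_im (𝕜 := ℂ) (e y)
    simpa using this

end Conv

section MS

variable {S : Type*} [TopologicalSpace S] [T2Space S] [MeasurableSpace S] [BorelSpace S]

variable (S) in
/-- The space of complex Borel measures with regular total variation. Complex measures have
automatically finite total variation. -/
def regularMeasures : Submodule ℂ (ComplexMeasure S) where
  carrier := {μ | μ.variation.Regular}
  zero_mem' := by
    change (VectorMeasure.variation (0 : ComplexMeasure S)).Regular
    rw [VectorMeasure.variation_zero]; infer_instance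
  add_mem' := by
    intro μ ν hμ hν
    have h1 : μ.variation.Regular := hμ
    have h2 : ν.variation.Regular := hν
    have := regular_add (m := μ.variation) (n := ν.variation)
    exact regular_of_le VectorMeasure.variation_add_le
  smul_mem' := by
    intro c μ hμ
    have h1 : μ.variation.Regular := hμ
    change (c • μ).variation.Regular
    rw [VectorMeasure.variation_smul]; infer_instance

variable (S) in
/-- `M(S)`: the bounded regular complex Borel measures on `S`. -/
def M : Type _ := regularMeasures S

instance : AddCommGroup (M S) := inferInstanceAs (AddCommGroup (regularMeasures S))
instance : Module ℂ (M S) := inferInstanceAs (Module ℂ (regularMeasures S))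

/-- The total variation measure `|μ|`. -/
def M.var (μ : M S) : Measure S := μ.1.variation

instance (μ : M S) : IsFiniteMeasure μ.var := finite_variation μ.1
instance (μ : M S) : μ.var.Regular := μ.2

/-- The integral `∫ f dμ`. -/
def M.int (μ : M S) (f : S → ℂ) : ℂ := cint μ.1 f

/-- A positive finite regular measure as an element of `M(S)`. -/
def ofM (n : Measure S) [IsFiniteMeasure n] [h : n.Regular] : M S :=
  ⟨toC n, by change (toC n).variation.Regular; rwa [variation_toC]⟩

theorem var_ofM (n : Measure S) [IsFiniteMeasure n] [n.Regular] : (ofM n).var = n :=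
  variation_toC n

theorem var_add_le (μ ν : M S) : (μ + ν).var ≤ μ.var + ν.var := VectorMeasure.variation_add_le

theorem var_smul (c : ℂ) (μ : M S) : (c • μ).var = ‖c‖₊ • μ.var := VectorMeasure.variation_smul

/-- The total variation norm `‖μ‖ = ∫ d|μ|`. -/
instance : Norm (M S) := ⟨fun μ => μ.var.real Set.univ⟩

theorem norm_def (μ : M S) : ‖μ‖ = μ.var.real Set.univ := rfl

theorem M.core : NormedSpace.Core ℂ (M S) where
  norm_nonneg _ := measureReal_nonneg
  norm_smul c μ := by
    rw [norm_def, norm_def, var_smul, measureReal_def, measureReal_def, Measure.smul_apply,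
      ENNReal.smul_def, smul_eq_mul, ENNReal.toReal_mul]
    simp
  norm_triangle μ ν := by
    rw [norm_def, norm_def, norm_def, ← measureReal_add_apply]
    exact ENNReal.toReal_mono (measure_ne_top _ _) (var_add_le μ ν _)
  norm_eq_zero_iff μ := by
    constructor
    · intro h
      have h0 : μ.var Set.univ = 0 := by
        rw [norm_def, measureReal_def] at h
        exact (ENNReal.toReal_eq_zero_iff _).1 h |>.resolve_right (measure_ne_top _ _)
      refine Subtype.ext (VectorMeasure.ext fun A hA => ?_)
      exact (VectorMeasure.variation_apply_eq_zero MeasurableSet.univ).1 h0 A (Set.subset_univ _) hA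
    · rintro rfl
      rw [norm_def, measureReal_def]
      have : (0 : M S).var = 0 := VectorMeasure.variation_zero
      simp [this]

instance : NormedAddCommGroup (M S) := NormedAddCommGroup.ofCore M.core
instance : NormedSpace ℂ (M S) := NormedSpace.ofCore M.core

theorem exists_decomp_M (μ : M S) :
    ∃ m : Fin 4 → Measure S, ∃ _ : ∀ i, IsFiniteMeasure (m i), ∃ _ : ∀ i, (m i).Regular,
      (∀ i, m i ≤ μ.var) ∧
      μ = ofM (m 0) - ofM (m 1) + Complex.I • (ofM (m 2) - ofM (m 3)) := by
  obtain ⟨m, hf, hle, he⟩ := exists_decomp μ.1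
  exact ⟨m, hf, fun i => regular_of_le (m := μ.var) (hle i), hle, Subtype.ext he⟩

theorem M.ind {P : M S → Prop}
    (pos : ∀ (n : Measure S) [IsFiniteMeasure n] [n.Regular], P (ofM n))
    (add : ∀ μ ν, P μ → P ν → P (μ + ν)) (smul : ∀ (c : ℂ) μ, P μ → P (c • μ)) (μ : M S) :
    P μ := by
  obtain ⟨m, hf, hr, hle, he⟩ := exists_decomp_M μ
  rw [he]
  have hsub : ∀ μ ν, P μ → P ν → P (μ - ν) := fun μ ν h1 h2 => by
    rw [sub_eq_add_neg, ← neg_one_smul ℂ ν]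
    exact add _ _ h1 (smul _ _ h2)
  exact add _ _ (hsub _ _ (pos _) (pos _)) (smul _ _ (hsub _ _ (pos _) (pos _)))

theorem integrable_M (μ : M S) {f : S → ℂ} (hf : Continuous f) {C : ℝ} (hC : ∀ x, ‖f x‖ ≤ C) :
    Integrable f μ.1.variation := integrable_of_bdd hf hC

theorem int_ofM (n : Measure S) [IsFiniteMeasure n] [n.Regular] (f : S → ℂ) :
    (ofM n).int f = ∫ x, f x ∂n := cint_toC n f

theorem int_add (μ ν : M S) {f : S → ℂ} (hf : Continuous f) {C : ℝ} (hC : ∀ x, ‖f x‖ ≤ C) :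
    (μ + ν).int f = μ.int f + ν.int f :=
  cint_add μ.1 ν.1 (integrable_M μ hf hC) (integrable_M ν hf hC)

theorem int_smul (c : ℂ) (μ : M S) {f : S → ℂ} (hf : Continuous f) {C : ℝ}
    (hC : ∀ x, ‖f x‖ ≤ C) : (c • μ).int f = c * μ.int f :=
  cint_smul c μ.1 (integrable_M μ hf hC)

theorem int_sub (μ ν : M S) {f : S → ℂ} (hf : Continuous f) {C : ℝ} (hC : ∀ x, ‖f x‖ ≤ C) :
    (μ - ν).int f = μ.int f - ν.int f := by
  rw [sub_eq_add_neg, ← neg_one_smul ℂ ν, int_add _ _ hf hC, int_smul _ _ hf hC]; ring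

theorem int_fun_add (μ : M S) {f g : S → ℂ} (hf : Continuous f) {C : ℝ} (hC : ∀ x, ‖f x‖ ≤ C)
    (hg : Continuous g) {D : ℝ} (hD : ∀ x, ‖g x‖ ≤ D) :
    μ.int (fun x => f x + g x) = μ.int f + μ.int g :=
  VectorMeasure.integral_fun_add (integrable_M μ hf hC) (integrable_M μ hg hD)

theorem int_fun_smul (μ : M S) (c : ℂ) {f : S → ℂ} (hf : Continuous f) {C : ℝ}
    (hC : ∀ x, ‖f x‖ ≤ C) : μ.int (fun x => c * f x) = c * μ.int f := by
  have hcf : Continuous fun x => c * f x := continuous_const.mul hf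
  have hcC : ∀ x, ‖c * f x‖ ≤ ‖c‖ * C := fun x => by
    rw [norm_mul]; exact mul_le_mul_of_nonneg_left (hC x) (norm_nonneg _)
  induction μ using M.ind with
  | pos n => rw [int_ofM, int_ofM, integral_const_mul]
  | add μ ν h1 h2 => rw [int_add _ _ hcf hcC, int_add _ _ hf hC, h1, h2, mul_add]
  | smul d μ h => rw [int_smul _ _ hcf hcC, int_smul _ _ hf hC, h]; ring

theorem norm_int_le (μ : M S) {f : S → ℂ} {C : ℝ} (hC : ∀ x, ‖f x‖ ≤ C) :
    ‖μ.int f‖ ≤ C * ‖μ‖ := by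
  have h := VectorMeasure.norm_integral_le_of_norm_le_const (μ := μ.1)
    (B := ContinuousLinearMap.mul ℝ ℂ) (Eventually.of_forall hC)
  rwa [ContinuousLinearMap.opNorm_mul, mul_one] at h

variable [LocallyCompactSpace S]

/-- A regular measure is determined by its integrals of compactly supported functions. -/
theorem M.ext_of_int {μ ν : M S} (h : ∀ f : C_c(S, ℝ), μ.int (fun x => f x) = ν.int fun x => f x) :
    μ = ν := by
  rw [← sub_eq_zero]
  have h0 : ∀ f : C_c(S, ℝ), (μ - ν).int (fun x => f x) = 0 := fun f => by
    obtain ⟨C, hC⟩ := f.hasCompactSupport.exists_bound_of_continuous f.continuous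
    rw [int_sub μ ν (f := fun x => (f x : ℂ)) (Complex.continuous_ofReal.comp f.continuous)
      (C := C) (fun x => by rw [Complex.norm_real]; exact hC x), h f, sub_self]
  generalize μ - ν = κ at h0
  obtain ⟨m, hf, hr, hle, he⟩ := exists_decomp_M κ
  have key : ∀ f : C_c(S, ℝ), ∫ x, f x ∂(m 0) = ∫ x, f x ∂(m 1) ∧
      ∫ x, f x ∂(m 2) = ∫ x, f x ∂(m 3) := fun f => by
    obtain ⟨C, hC⟩ := f.hasCompactSupport.exists_bound_of_continuous f.continuous
    have hfc : Continuous fun x => (f x : ℂ) := Complex.continuous_ofReal.comp f.continuous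
    have hfC : ∀ x, ‖(f x : ℂ)‖ ≤ C := fun x => by rw [Complex.norm_real]; exact hC x
    have h1 := h0 f
    rw [he, int_add _ _ hfc hfC, int_smul _ _ hfc hfC, int_sub _ _ hfc hfC, int_sub _ _ hfc hfC]
      at h1
    simp only [int_ofM, integral_complex_ofReal] at h1
    have hre := congrArg Complex.re h1
    have him := congrArg Complex.im h1
    simp at hre him
    exact ⟨by linarith, by linarith⟩
  have e1 : m 0 = m 1 := Measure.ext_of_integral_eq_on_compactlySupported fun f => (key f).1
  have e2 : m 2 = m 3 := Measure.ext_of_integral_eq_on_compactlySupported fun f => (key f).2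
  rw [he]
  simp only [e1, e2, sub_self, smul_zero, add_zero]

theorem int_param {Y : Type*} [TopologicalSpace Y] (μ : M S) {H : Y → S → ℂ}
    (hH : Continuous fun p : Y × S => H p.1 p.2) {C : ℝ} (hC : ∀ y x, ‖H y x‖ ≤ C) :
    Continuous fun y => μ.int (H y) := by
  have hy : ∀ y, Continuous (H y) := fun y => hH.comp (Continuous.prodMk_right y)
  induction μ using M.ind with
  | pos n => simpa only [int_ofM] using continuous_param n hH hC
  | add μ ν h1 h2 =>
    simp only [int_add _ _ (hy _) (hC _)]
    exact h1.add h2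
  | smul d μ h =>
    simp only [int_smul _ _ (hy _) (hC _)]
    exact continuous_const.mul h

theorem int_fubini (μ ν : M S) {H : S → S → ℂ}
    (hH : Continuous fun p : S × S => H p.1 p.2) {C : ℝ} (hC : ∀ y x, ‖H y x‖ ≤ C) :
    μ.int (fun x => ν.int fun y => H x y) = ν.int fun y => μ.int fun x => H x y := by
  have hl : ∀ x, Continuous (fun y => H x y) := fun y => hH.comp (Continuous.prodMk_right y)
  have hr : ∀ y, Continuous (fun x => H x y) := fun y => hH.comp (Continuous.prodMk_left y)
  have hs : Continuous fun p : S × S => H p.2 p.1 := hH.comp continuous_swap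
  have cl : ∀ ν : M S, Continuous fun x => ν.int fun y => H x y := fun ν => int_param ν hH hC
  have cr : ∀ μ : M S, Continuous fun y => μ.int fun x => H x y := fun μ =>
    int_param μ hs fun y x => hC x y
  have bl : ∀ ν : M S, ∀ x, ‖ν.int fun y => H x y‖ ≤ C * ‖ν‖ := fun ν x => norm_int_le ν (hC x)
  have br : ∀ μ : M S, ∀ y, ‖μ.int fun x => H x y‖ ≤ C * ‖μ‖ := fun μ y =>
    norm_int_le μ fun x => hC x y
  induction μ using M.ind with
  | pos m =>
    induction ν using M.ind with
    | pos n => simpa only [int_ofM] using fubini m n hH hC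
    | add ν₁ ν₂ h1 h2 =>
      simp only [int_add ν₁ ν₂ (hl _) (hC _)]
      rw [int_fun_add _ (cl _) (bl _) (cl _) (bl _), h1, h2, int_add _ _ (cr _) (br _)]
    | smul d ν h =>
      simp only [int_smul d ν (hl _) (hC _)]
      rw [int_fun_smul _ _ (cl _) (bl _), h, int_smul _ _ (cr _) (br _)]
  | add μ₁ μ₂ h1 h2 =>
    simp only [int_add μ₁ μ₂ (hr _) (fun x => hC x _)]
    rw [int_fun_add _ (cr _) (br _) (cr _) (br _), ← h1, ← h2, int_add _ _ (cl _) (bl _)]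
  | smul d μ h =>
    simp only [int_smul d μ (hr _) (fun x => hC x _)]
    rw [int_fun_smul _ _ (cr _) (br _), ← h, int_smul _ _ (cl _) (bl _)]

end MS

section Algebra

variable {S : Type*} [TopologicalSpace S] [T2Space S] [MeasurableSpace S] [BorelSpace S]
  [LocallyCompactSpace S]

section MulOnly
variable [Mul S] [ContinuousMul S]

theorem continuous_inner (μ : M S) {f : S → ℂ} (hf : Continuous f) {C : ℝ}
    (hC : ∀ x, ‖f x‖ ≤ C) : Continuous fun y => μ.int fun x => f (x * y) :=
  int_param μ (H := fun y x => f (x * y)) (hf.comp (continuous_snd.mul continuous_fst))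
    fun _ _ => hC _

theorem bound_inner (μ : M S) {f : S → ℂ} {C : ℝ}
    (hC : ∀ x, ‖f x‖ ≤ C) (y : S) : ‖μ.int fun x => f (x * y)‖ ≤ C * ‖μ‖ :=
  norm_int_le μ fun x => hC (x * y)

theorem exists_conv (μ ν : M S) : ∃ κ : M S, ∀ f : S → ℂ, Continuous f → (∃ C, ∀ x, ‖f x‖ ≤ C) →
    κ.int f = ν.int fun y => μ.int fun x => f (x * y) := by
  induction μ using M.ind with
  | pos m =>
    induction ν using M.ind with
    | pos n =>
      obtain ⟨k, h1, h2, h3, h4⟩ := exists_conv_pos m n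
      refine ⟨ofM k, fun f hf hC => ?_⟩
      simpa only [int_ofM] using h4 f hf hC
    | add ν₁ ν₂ h1 h2 =>
      obtain ⟨κ₁, h1⟩ := h1
      obtain ⟨κ₂, h2⟩ := h2
      refine ⟨κ₁ + κ₂, fun f hf hC => ?_⟩
      obtain ⟨C, hC'⟩ := id hC
      rw [int_add _ _ hf hC', h1 f hf hC, h2 f hf hC,
        int_add _ _ (continuous_inner _ hf hC') (bound_inner _ hC')]
    | smul d ν h =>
      obtain ⟨κ, h⟩ := h
      refine ⟨d • κ, fun f hf hC => ?_⟩
      obtain ⟨C, hC'⟩ := id hC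
      rw [int_smul _ _ hf hC', h f hf hC,
        int_smul _ _ (continuous_inner _ hf hC') (bound_inner _ hC')]
  | add μ₁ μ₂ h1 h2 =>
    obtain ⟨κ₁, h1⟩ := h1
    obtain ⟨κ₂, h2⟩ := h2
    refine ⟨κ₁ + κ₂, fun f hf hC => ?_⟩
    obtain ⟨C, hC'⟩ := id hC
    have hr : ∀ y, Continuous fun x => f (x * y) := fun y => hf.comp (continuous_mul_const y)
    simp only [int_add μ₁ μ₂ (hr _) (fun x => hC' _)]
    rw [int_add _ _ hf hC', h1 f hf hC, h2 f hf hC,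
      int_fun_add _ (continuous_inner _ hf hC') (bound_inner _ hC')
        (continuous_inner _ hf hC') (bound_inner _ hC')]
  | smul d μ h =>
    obtain ⟨κ, h⟩ := h
    refine ⟨d • κ, fun f hf hC => ?_⟩
    obtain ⟨C, hC'⟩ := id hC
    have hr : ∀ y, Continuous fun x => f (x * y) := fun y => hf.comp (continuous_mul_const y)
    simp only [int_smul d μ (hr _) (fun x => hC' _)]
    rw [int_smul _ _ hf hC', h f hf hC,
      int_fun_smul _ _ (continuous_inner _ hf hC') (bound_inner _ hC')]

theorem exists_conv_C0 (μ ν : M S) : ∃ κ : M S, ∀ f : C₀(S, ℂ),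
    κ.int f = ν.int fun y => μ.int fun x => f (x * y) := by
  obtain ⟨κ, h⟩ := exists_conv μ ν
  refine ⟨κ, fun f => h f f.continuous ⟨‖f.toBCF‖, fun x => f.toBCF.norm_coe_le_norm x⟩⟩

/-- Convolution: `μ * ν` is the measure with `∫ f d(μ * ν) = ∫∫ f(xy) dμ(x) dν(y)` for all
`f ∈ C₀(S)`. -/
instance : Mul (M S) := ⟨fun μ ν => Classical.choose (exists_conv_C0 μ ν)⟩

theorem conv_spec_C0 (μ ν : M S) (f : C₀(S, ℂ)) :
    (μ * ν).int f = ν.int fun y => μ.int fun x => f (x * y) :=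
  Classical.choose_spec (exists_conv_C0 μ ν) f

theorem conv_spec (μ ν : M S) {f : S → ℂ} (hf : Continuous f) {C : ℝ} (hC : ∀ x, ‖f x‖ ≤ C) :
    (μ * ν).int f = ν.int fun y => μ.int fun x => f (x * y) := by
  obtain ⟨κ, h⟩ := exists_conv μ ν
  have : μ * ν = κ := by
    refine M.ext_of_int fun g => ?_
    let g' : C₀(S, ℂ) := ⟨⟨fun x => (g x : ℂ), Complex.continuous_ofReal.comp g.continuous⟩, by
      refine HasCompactSupport.is_zero_at_infty ?_
      exact g.hasCompactSupport.comp_left (g := fun r : ℝ => (r : ℂ)) Complex.ofReal_zero⟩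
    have h1 := conv_spec_C0 μ ν g'
    have h2 := h g' g'.continuous ⟨‖g'.toBCF‖, fun x => g'.toBCF.norm_coe_le_norm x⟩
    exact h1.trans h2.symm
  rw [this]
  exact h f hf ⟨C, hC⟩

theorem M.ext_bdd {μ ν : M S} (h : ∀ f : S → ℂ, Continuous f → ∀ C : ℝ, (∀ x, ‖f x‖ ≤ C) →
    μ.int f = ν.int f) : μ = ν := by
  refine M.ext_of_int fun f => ?_
  obtain ⟨C, hC⟩ := f.hasCompactSupport.exists_bound_of_continuous f.continuous
  exact h _ (Complex.continuous_ofReal.comp f.continuous) C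
    fun x => by rw [Complex.norm_real]; exact hC x

theorem M.add_mul' (μ ν κ : M S) : (μ + ν) * κ = μ * κ + ν * κ := by
  refine M.ext_bdd fun f hf C hC => ?_
  have hr : ∀ y, Continuous fun x => f (x * y) := fun y => hf.comp (continuous_mul_const y)
  rw [int_add _ _ hf hC, conv_spec _ _ hf hC, conv_spec _ _ hf hC, conv_spec _ _ hf hC]
  simp only [int_add μ ν (hr _) (fun x => hC _)]
  exact int_fun_add _ (continuous_inner _ hf hC) (bound_inner _ hC)
        (continuous_inner _ hf hC) (bound_inner _ hC)

theorem M.mul_add' (μ ν κ : M S) : μ * (ν + κ) = μ * ν + μ * κ := by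
  refine M.ext_bdd fun f hf C hC => ?_
  rw [int_add _ _ hf hC, conv_spec _ _ hf hC, conv_spec _ _ hf hC, conv_spec _ _ hf hC,
    int_add _ _ (continuous_inner _ hf hC) (bound_inner _ hC)]

theorem M.smul_mul' (c : ℂ) (μ κ : M S) : (c • μ) * κ = c • (μ * κ) := by
  refine M.ext_bdd fun f hf C hC => ?_
  have hr : ∀ y, Continuous fun x => f (x * y) := fun y => hf.comp (continuous_mul_const y)
  rw [int_smul _ _ hf hC, conv_spec _ _ hf hC, conv_spec _ _ hf hC]
  simp only [int_smul c μ (hr _) (fun x => hC _)]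
  exact int_fun_smul _ _ (continuous_inner _ hf hC) (bound_inner _ hC)

theorem M.mul_smul' (c : ℂ) (μ κ : M S) : μ * (c • κ) = c • (μ * κ) := by
  refine M.ext_bdd fun f hf C hC => ?_
  rw [int_smul _ _ hf hC, conv_spec _ _ hf hC, conv_spec _ _ hf hC,
    int_smul _ _ (continuous_inner _ hf hC) (bound_inner _ hC)]

end MulOnly

section Semi
variable [Semigroup S] [ContinuousMul S]

theorem M.mul_assoc' (μ ν κ : M S) : μ * ν * κ = μ * (ν * κ) := by
  refine M.ext_bdd fun f hf C hC => ?_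
  rw [conv_spec _ _ hf hC, conv_spec _ _ hf hC,
    conv_spec _ _ (continuous_inner _ hf hC) (bound_inner _ hC)]
  congr 1 with z
  have hr : Continuous fun x => f (x * z) := hf.comp (continuous_mul_const z)
  rw [conv_spec _ _ hr (fun x => hC _)]
  simp only [mul_assoc]

instance : NonUnitalRing (M S) where
  left_distrib := M.mul_add'
  right_distrib := M.add_mul'
  zero_mul μ := by
    have := M.smul_mul' 0 (0 : M S) μ
    simpa only [zero_smul] using this
  mul_zero μ := by
    have := M.mul_smul' 0 μ (0 : M S)
    simpa only [zero_smul] using this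
  mul_assoc := M.mul_assoc'

instance : IsScalarTower ℂ (M S) (M S) := ⟨fun c μ ν => M.smul_mul' c μ ν⟩
instance : SMulCommClass ℂ (M S) (M S) := ⟨fun c μ ν => (M.mul_smul' c μ ν).symm⟩

end Semi

section Star
variable [InvolutiveStar S] [ContinuousStar S]

/-- The involution `μ*(A) = conj (μ (A*))` on complex measures. -/
def cstar (μ : ComplexMeasure S) : ComplexMeasure S :=
  (μ.map star).mapRange (starRingEnd ℂ : ℂ →+ ℂ) Complex.continuous_conj

theorem measurable_star' : Measurable (star : S → S) := continuous_star.measurable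

theorem cstar_apply (μ : ComplexMeasure S) {A : Set S} (hA : MeasurableSet A) :
    cstar μ A = conj (μ (star ⁻¹' A)) := by
  change conj ((μ.map star) A) = _
  rw [VectorMeasure.map_apply _ measurable_star' hA]

theorem cstar_cstar (μ : ComplexMeasure S) : cstar (cstar μ) = μ := by
  ext A hA
  rw [cstar_apply _ hA, cstar_apply _ (measurable_star' hA), Complex.conj_conj,
    ← Set.preimage_comp]
  have : (star ∘ star : S → S) = id := by ext x; simp
  rw [this, Set.preimage_id]

theorem variation_cstar_le (μ : ComplexMeasure S) :
    (cstar μ).variation ≤ μ.variation.map star := by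
  refine VectorMeasure.variation_le_of_forall_enorm_le fun A hA => ?_
  rw [cstar_apply μ hA, Measure.map_apply measurable_star' hA, ← ofReal_norm, RCLike.norm_conj,
    ofReal_norm]
  exact VectorMeasure.enorm_measure_le_variation _ _

theorem variation_cstar (μ : ComplexMeasure S) :
    (cstar μ).variation = μ.variation.map star := by
  refine le_antisymm (variation_cstar_le μ) ?_
  have h := variation_cstar_le (cstar μ)
  rw [cstar_cstar] at h
  refine (Measure.map_mono h measurable_star').trans_eq ?_
  rw [Measure.map_map measurable_star' measurable_star']
  have : (star ∘ star : S → S) = id := by ext x; simp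
  rw [this, Measure.map_id]

/-- The involution on `M(S)`. -/
instance : Star (M S) := ⟨fun μ => ⟨cstar μ.1, by
  change (cstar μ.1).variation.Regular
  rw [variation_cstar]
  exact regular_map (m := μ.var) continuous_star⟩⟩

theorem var_star (μ : M S) : (star μ).var = μ.var.map star := variation_cstar μ.1

theorem star_ofM (n : Measure S) [IsFiniteMeasure n] [n.Regular] :
    star (ofM n) = @ofM S _ _ _ _ (n.map star) inferInstance (regular_map continuous_star) := by
  refine Subtype.ext (VectorMeasure.ext fun A hA => ?_)
  change cstar (toC n) A = toC (n.map star) A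
  rw [cstar_apply _ hA, toC_apply _ (measurable_star' hA), toC_apply _ hA, Complex.conj_ofReal,
    measureReal_def, measureReal_def, Measure.map_apply measurable_star' hA]

theorem M.star_add' (μ ν : M S) : star (μ + ν) = star μ + star ν := by
  refine Subtype.ext (VectorMeasure.ext fun A hA => ?_)
  change cstar (μ.1 + ν.1) A = cstar μ.1 A + cstar ν.1 A
  rw [cstar_apply _ hA, cstar_apply _ hA, cstar_apply _ hA, ← map_add]
  rfl

theorem M.star_smul' (c : ℂ) (μ : M S) : star (c • μ) = conj c • star μ := by
  refine Subtype.ext (VectorMeasure.ext fun A hA => ?_)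
  change cstar (c • μ.1) A = conj c * cstar μ.1 A
  rw [cstar_apply _ hA, cstar_apply _ hA, ← map_mul]
  rfl

theorem norm_star' (μ : M S) : ‖star μ‖ = ‖μ‖ := by
  rw [norm_def, norm_def, var_star, measureReal_def, measureReal_def,
    Measure.map_apply measurable_star' MeasurableSet.univ, Set.preimage_univ]

theorem int_star (μ : M S) {f : S → ℂ} (hf : Continuous f) {C : ℝ} (hC : ∀ x, ‖f x‖ ≤ C) :
    (star μ).int f = conj (μ.int fun x => conj (f (star x))) := by
  have hg : Continuous fun x => conj (f (star x)) :=
    Complex.continuous_conj.comp (hf.comp continuous_star)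
  have hgC : ∀ x, ‖conj (f (star x))‖ ≤ C := fun x => by rw [RCLike.norm_conj]; exact hC _
  induction μ using M.ind with
  | pos n =>
    have : (n.map star).Regular := regular_map (m := n) continuous_star
    rw [star_ofM, int_ofM, int_ofM, integral_map measurable_star'.aemeasurable
      hf.aestronglyMeasurable, integral_conj, Complex.conj_conj]
  | add μ ν h1 h2 => rw [M.star_add', int_add _ _ hf hC, int_add _ _ hg hgC, h1, h2, map_add]
  | smul d μ h => rw [M.star_smul', int_smul _ _ hf hC, int_smul _ _ hg hgC, h, map_mul]

end Star

section StarSemi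
variable [Semigroup S] [ContinuousMul S] [StarMul S] [ContinuousStar S]

theorem M.star_mul' (μ ν : M S) : star (μ * ν) = star ν * star μ := by
  refine M.ext_bdd fun f hf C hC => ?_
  have hg : Continuous fun x => conj (f (star x)) :=
    Complex.continuous_conj.comp (hf.comp continuous_star)
  have hgC : ∀ x, ‖conj (f (star x))‖ ≤ C := fun x => by rw [RCLike.norm_conj]; exact hC _
  have hr : ∀ y, Continuous fun x => f (x * y) := fun y => hf.comp (continuous_mul_const y)
  have hk : Continuous fun p : S × S => conj (f (star p.2 * star p.1)) := by
    refine Complex.continuous_conj.comp (hf.comp ?_)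
    exact (continuous_star.comp continuous_snd).mul (continuous_star.comp continuous_fst)
  have hkC : ∀ x y : S, ‖conj (f (star y * star x))‖ ≤ C := fun x y => by
    rw [RCLike.norm_conj]; exact hC _
  have h1 : (star (μ * ν)).int f = conj (ν.int fun y => μ.int fun x =>
      conj (f (star y * star x))) := by
    rw [int_star _ hf hC, conv_spec _ _ hg hgC]
    simp only [star_mul]
  have h2 : ∀ z, ((star ν).int fun x => f (x * star z)) =
      conj (ν.int fun y => conj (f (star y * star z))) := fun z =>
    int_star ν (hr (star z)) (fun x => hC _)
  have h3 : (star ν * star μ).int f = conj (μ.int fun x => ν.int fun y =>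
      conj (f (star y * star x))) := by
    rw [conv_spec _ _ hf hC, int_star _ (continuous_inner _ hf hC) (bound_inner _ hC)]
    simp only [h2, Complex.conj_conj]
  rw [h1, h3, int_fubini μ ν (H := fun x y => conj (f (star y * star x))) hk hkC]

instance : StarRing (M S) where
  star_involutive μ := Subtype.ext (cstar_cstar μ.1)
  star_mul := M.star_mul'
  star_add := M.star_add'

instance : StarModule ℂ (M S) := ⟨M.star_smul'⟩

end StarSemi

end Algebra

section Solid

variable {S : Type*} [TopologicalSpace S] [T2Space S] [MeasurableSpace S] [BorelSpace S]

theorem ofM_congr {m n : Measure S} [IsFiniteMeasure m] [m.Regular] [IsFiniteMeasure n]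
    [n.Regular] (h : m = n) : ofM m = ofM n := by subst h; rfl

theorem ofM_add (m n : Measure S) [IsFiniteMeasure m] [m.Regular] [IsFiniteMeasure n]
    [n.Regular] [(m + n).Regular] : ofM (m + n) = ofM m + ofM n :=
  Subtype.ext (toC_add m n)

theorem norm_ofM (m : Measure S) [IsFiniteMeasure m] [m.Regular] :
    ‖ofM m‖ = m.real Set.univ := by rw [norm_def, var_ofM]

theorem ofM_zero : ofM (0 : Measure S) = 0 := by
  rw [← norm_eq_zero, norm_ofM]; simp

/-- The values of a real functional on the positive measures below `n`. -/
def lowerVals (r : M S →L[ℝ] ℝ) (n : Measure S) : Set ℝ :=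
  {t | ∃ l : Measure S, ∃ _ : IsFiniteMeasure l, ∃ _ : l.Regular, l ≤ n ∧ r (ofM l) = t}

theorem lowerVals_bdd (r : M S →L[ℝ] ℝ) (n : Measure S) [IsFiniteMeasure n] {t : ℝ}
    (ht : t ∈ lowerVals r n) : t ≤ ‖r‖ * n.real Set.univ := by
  obtain ⟨l, _, _, hl, rfl⟩ := ht
  refine (le_abs_self _).trans ((r.le_opNorm _).trans ?_)
  rw [norm_ofM]
  exact mul_le_mul_of_nonneg_left (ENNReal.toReal_mono (measure_ne_top _ _) (hl _)) (norm_nonneg _)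

theorem lowerVals_zero (r : M S →L[ℝ] ℝ) (n : Measure S) : (0 : ℝ) ∈ lowerVals r n :=
  ⟨0, inferInstance, inferInstance, Measure.zero_le _, by rw [ofM_zero, map_zero]⟩

/-- The positive part of a real functional, on positive measures. -/
def posPart (r : M S →L[ℝ] ℝ) (n : Measure S) : ℝ := sSup (lowerVals r n)

theorem le_posPart (r : M S →L[ℝ] ℝ) (n l : Measure S) [IsFiniteMeasure n] [IsFiniteMeasure l]
    [l.Regular] (h : l ≤ n) : r (ofM l) ≤ posPart r n :=
  le_csSup ⟨_, fun _ ht => lowerVals_bdd r n ht⟩ ⟨l, inferInstance, inferInstance, h, rfl⟩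

theorem posPart_nonneg (r : M S →L[ℝ] ℝ) (n : Measure S) [IsFiniteMeasure n] :
    0 ≤ posPart r n :=
  le_csSup ⟨_, fun _ ht => lowerVals_bdd r n ht⟩ (lowerVals_zero r n)

theorem posPart_le (r : M S →L[ℝ] ℝ) (n : Measure S) [IsFiniteMeasure n] :
    posPart r n ≤ ‖r‖ * n.real Set.univ :=
  csSup_le ⟨0, lowerVals_zero r n⟩ fun _ ht => lowerVals_bdd r n ht

theorem posPart_add (r : M S →L[ℝ] ℝ) (m n : Measure S) [IsFiniteMeasure m] [m.Regular]
    [IsFiniteMeasure n] [n.Regular] : posPart r (m + n) = posPart r m + posPart r n := by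
  refine le_antisymm (csSup_le ⟨0, lowerVals_zero r _⟩ ?_) ?_
  · rintro t ⟨l, hf, hr, hl, rfl⟩
    have hac : l ≪ m + n := Measure.absolutelyContinuous_of_le hl
    set h : S → ℝ≥0∞ := fun x => min (l.rnDeriv (m + n) x) 1 with hh
    have hmeas : Measurable h := (Measure.measurable_rnDeriv l (m + n)).min measurable_const
    have h1 : (m + n).withDensity h = l := by
      rw [← Measure.withDensity_rnDeriv_eq l (m + n) hac]
      refine withDensity_congr_ae ?_
      filter_upwards [Measure.rnDeriv_le_one_of_le hl] with x hx
      simp only [hh]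
      exact min_eq_left hx
    have hle : ∀ k : Measure S, k.withDensity h ≤ k := fun k => by
      conv_rhs => rw [← withDensity_one (μ := k)]
      exact withDensity_mono (Eventually.of_forall fun x => min_le_right _ _)
    have e : m.withDensity h + n.withDensity h = l := by
      rw [← h1, withDensity_add_measure]
    have f1 : IsFiniteMeasure (m.withDensity h) := isFiniteMeasure_of_le _ (hle m)
    have f2 : IsFiniteMeasure (n.withDensity h) := isFiniteMeasure_of_le _ (hle n)
    have r1 : (m.withDensity h).Regular := regular_of_le (hle m)
    have r2 : (n.withDensity h).Regular := regular_of_le (hle n)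
    have r3 : (m.withDensity h + n.withDensity h).Regular := regular_add
    rw [← ofM_congr e, ofM_add, map_add]
    exact add_le_add (le_posPart r m _ (hle m)) (le_posPart r n _ (hle n))
  · rw [← le_sub_iff_add_le]
    refine csSup_le ⟨0, lowerVals_zero r _⟩ ?_
    rintro t ⟨l, hf, hr, hl, rfl⟩
    rw [le_sub_comm]
    refine csSup_le ⟨0, lowerVals_zero r _⟩ ?_
    rintro t ⟨k, hf', hr', hk, rfl⟩
    rw [le_sub_iff_add_le, add_comm, ← map_add]
    have : (l + k).Regular := regular_add
    rw [← ofM_add]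
    exact le_posPart r (m + n) (l + k) (add_le_add hl hk)

theorem exists_re_decomp (μ : M S) : ∃ a b : Measure S, IsFiniteMeasure a ∧ IsFiniteMeasure b ∧
    a.Regular ∧ b.Regular ∧ a ≤ μ.var ∧ b ≤ μ.var ∧
    ∀ A, MeasurableSet A → (μ.1 A).re = a.real A - b.real A := by
  obtain ⟨m, hf, hr, hle, he⟩ := exists_decomp_M μ
  refine ⟨m 0, m 1, hf 0, hf 1, hr 0, hr 1, hle 0, hle 1, fun A hA => ?_⟩
  have : μ.1 = toC (m 0) - toC (m 1) + Complex.I • (toC (m 2) - toC (m 3)) :=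
    congrArg Subtype.val he
  rw [this]
  simp [toC_apply _ hA]

/-- An additive bounded function on positive regular measures extends to a real functional. -/
theorem exists_extend (p : Measure S → ℝ) {C : ℝ}
    (hadd : ∀ (m n : Measure S) [IsFiniteMeasure m] [m.Regular] [IsFiniteMeasure n] [n.Regular],
      p (m + n) = p m + p n)
    (hbd : ∀ (m : Measure S) [IsFiniteMeasure m] [m.Regular], |p m| ≤ C * m.real Set.univ)
    (hC : 0 ≤ C) :
    ∃ r : M S →L[ℝ] ℝ, ∀ (n : Measure S) [IsFiniteMeasure n] [n.Regular], r (ofM n) = p n := by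
  choose a b hfa hfb hra hrb hla hlb hab using exists_re_decomp (S := S)
  have wd : ∀ (μ : M S) (c d : Measure S) [IsFiniteMeasure c] [c.Regular] [IsFiniteMeasure d]
      [d.Regular], (∀ A, MeasurableSet A → (μ.1 A).re = c.real A - d.real A) →
      p (a μ) - p (b μ) = p c - p d := by
    intro μ c d _ _ _ _ h
    have e : a μ + d = c + b μ := by
      refine Measure.ext fun A hA => ?_
      have h1 := (hab μ A hA).symm.trans (h A hA)
      have h2 : (a μ + d).real A = (c + b μ).real A := by
        rw [measureReal_add_apply, measureReal_add_apply]; linarith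
      exact (ENNReal.toReal_eq_toReal_iff' (measure_ne_top _ _) (measure_ne_top _ _)).1 h2
    have := congrArg p e
    rw [hadd, hadd] at this
    linarith
  let f : M S →+ ℝ := AddMonoidHom.mk' (fun μ => p (a μ) - p (b μ)) fun μ ν => by
    have r1 : (a μ + a ν).Regular := regular_add
    have r2 : (b μ + b ν).Regular := regular_add
    rw [wd (μ + ν) (a μ + a ν) (b μ + b ν) ?_, hadd, hadd]
    · ring
    · intro A hA
      rw [measureReal_add_apply, measureReal_add_apply]
      have h1 : ((μ + ν).1 A).re = (μ.1 A).re + (ν.1 A).re := rfl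
      rw [h1, hab μ A hA, hab ν A hA]; ring
  have hf : ∀ μ, ‖f μ‖ ≤ (2 * C) * ‖μ‖ := fun μ => by
    have h1 := hbd (a μ)
    have h2 := hbd (b μ)
    have h3 : (a μ).real Set.univ ≤ ‖μ‖ := ENNReal.toReal_mono (measure_ne_top _ _) (hla μ _)
    have h4 : (b μ).real Set.univ ≤ ‖μ‖ := ENNReal.toReal_mono (measure_ne_top _ _) (hlb μ _)
    calc ‖f μ‖ ≤ |p (a μ)| + |p (b μ)| := abs_sub _ _
      _ ≤ C * ‖μ‖ + C * ‖μ‖ := add_le_add (h1.trans (mul_le_mul_of_nonneg_left h3 hC))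
          (h2.trans (mul_le_mul_of_nonneg_left h4 hC))
      _ = (2 * C) * ‖μ‖ := by ring
  refine ⟨f.toRealLinearMap (AddMonoidHomClass.continuous_of_bound f _ hf), fun n _ _ => ?_⟩
  have hp0 : p 0 = 0 := by
    have := hbd 0
    simp at this
    exact this
  change p (a (ofM n)) - p (b (ofM n)) = p n
  rw [wd (ofM n) n 0, hp0, sub_zero]
  intro A hA
  have : (ofM n).1 A = (n.real A : ℂ) := toC_apply n hA
  rw [this]; simp

section Density

variable (m : Measure S) [IsFiniteMeasure m] [m.Regular]

theorem regular_density {h : S → ℂ} (hh : Integrable h m) :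
    (VectorMeasure.variation (m.withDensityᵥ h)) ≤ m.withDensity fun x => ‖h x‖ₑ := by
  refine VectorMeasure.variation_le_of_forall_enorm_le fun A hA => ?_
  rw [withDensityᵥ_apply hh hA, withDensity_apply _ hA]
  exact enorm_integral_le_lintegral_enorm _

theorem regular_density' {h : S → ℂ} (hh : Integrable h m) :
    (VectorMeasure.variation (m.withDensityᵥ h)).Regular :=
  regular_of_ac (m := m) ((Measure.absolutelyContinuous_of_le (regular_density m hh)).trans
    (withDensity_absolutelyContinuous _ _))

/-- The measure `h m`. -/
def densM (h : S → ℂ) (hh : Integrable h m) : M S := ⟨m.withDensityᵥ h, regular_density' m hh⟩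

theorem norm_densM_le {h : S → ℂ} (hh : Integrable h m) : ‖densM m h hh‖ ≤ ∫ x, ‖h x‖ ∂m := by
  rw [norm_def, measureReal_def, integral_norm_eq_lintegral_enorm hh.1]
  refine ENNReal.toReal_mono hh.2.ne ?_
  refine (regular_density m hh Set.univ).trans_eq ?_
  rw [withDensity_apply _ MeasurableSet.univ, Measure.restrict_univ]

theorem integrable_lp (h : Lp ℝ 2 m) : Integrable (fun x => ((h x : ℝ) : ℂ)) m :=
  ((Lp.memLp h).integrable (by norm_num)).ofReal

/-- Functionals on densities are represented by square integrable functions. -/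
theorem exists_repr (r : M S →L[ℝ] ℝ) : ∃ f : S → ℝ, Integrable f m ∧
    ∀ (l : Measure S) [IsFiniteMeasure l] [l.Regular], l ≤ m →
      Integrable (fun x => f x * (l.rnDeriv m x).toReal) m ∧
      r (ofM l) = ∫ x, f x * (l.rnDeriv m x).toReal ∂m := by
  let T₀ : Lp ℝ 2 m →ₗ[ℝ] ℝ :=
    { toFun := fun h => r (densM m _ (integrable_lp m h))
      map_add' := fun h k => by
        rw [← map_add]
        congr 1
        refine Subtype.ext ?_
        change m.withDensityᵥ _ = m.withDensityᵥ _ + m.withDensityᵥ _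
        rw [← withDensityᵥ_add (integrable_lp m h) (integrable_lp m k)]
        refine WithDensityᵥEq.congr_ae ?_
        filter_upwards [Lp.coeFn_add h k] with x hx
        change (((h + k : Lp ℝ 2 m) x : ℝ) : ℂ) = ((h x : ℝ) : ℂ) + ((k x : ℝ) : ℂ)
        rw [hx, Pi.add_apply, Complex.ofReal_add]
      map_smul' := fun c h => by
        rw [← map_smul]
        congr 1
        refine Subtype.ext ?_
        change m.withDensityᵥ _ = (c : ℂ) • m.withDensityᵥ _
        rw [← withDensityᵥ_smul]
        refine WithDensityᵥEq.congr_ae ?_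
        filter_upwards [Lp.coeFn_smul c h] with x hx
        simp [hx] }
  have hT : ∀ h, ‖T₀ h‖ ≤ (‖r‖ * (m Set.univ ^ (1 / 2 : ℝ)).toReal) * ‖h‖ := fun h => by
    refine (r.le_opNorm _).trans ?_
    rw [mul_assoc]
    refine mul_le_mul_of_nonneg_left ((norm_densM_le m _).trans ?_) (norm_nonneg _)
    have h1 := eLpNorm_le_eLpNorm_mul_rpow_measure_univ (μ := m) (p := 1) (q := 2)
      (f := h) (by norm_num) (Lp.aestronglyMeasurable h)
    rw [Lp.norm_def, mul_comm, ← ENNReal.toReal_mul]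
    simp only [Complex.norm_real]
    rw [integral_norm_eq_lintegral_enorm (Lp.aestronglyMeasurable h), ← eLpNorm_one_eq_lintegral_enorm]
    refine ENNReal.toReal_mono (ENNReal.mul_ne_top (Lp.eLpNorm_ne_top h) ?_) (h1.trans_eq ?_)
    · exact ENNReal.rpow_ne_top_of_nonneg (by norm_num) (measure_ne_top _ _)
    · norm_num
  let T : Lp ℝ 2 m →L[ℝ] ℝ := T₀.mkContinuous _ hT
  let g : Lp ℝ 2 m := (InnerProductSpace.toDual ℝ (Lp ℝ 2 m)).symm T
  refine ⟨g, (Lp.memLp g).integrable (by norm_num), fun l _ _ hl => ?_⟩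
  have hb : ∀ᵐ x ∂m, ‖(l.rnDeriv m x).toReal‖ ≤ 1 := by
    filter_upwards [Measure.rnDeriv_le_one_of_le hl] with x hx
    rw [Real.norm_of_nonneg ENNReal.toReal_nonneg]
    exact ENNReal.toReal_le_of_le_ofReal zero_le_one (by simpa using hx)
  have hmem : MemLp (fun x => (l.rnDeriv m x).toReal) 2 m :=
    MemLp.of_bound (Measure.measurable_rnDeriv l m).ennreal_toReal.aestronglyMeasurable 1 hb
  have e1 : r (ofM l) = T (hmem.toLp _) := by
    change r (ofM l) = r (densM m _ (integrable_lp m _))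
    congr 1
    refine Subtype.ext (VectorMeasure.ext fun A hA => ?_)
    change toC l A = m.withDensityᵥ _ A
    rw [withDensityᵥ_apply (integrable_lp m _) hA, toC_apply l hA, integral_complex_ofReal]
    congr 1
    rw [← Measure.setIntegral_toReal_rnDeriv (Measure.absolutelyContinuous_of_le hl)]
    refine integral_congr_ae (ae_restrict_of_ae ?_)
    filter_upwards [hmem.coeFn_toLp] with x hx
    rw [hx]
  have e2 : T (hmem.toLp _) = inner ℝ g (hmem.toLp _) := by
    rw [← InnerProductSpace.toDual_apply_apply (𝕜 := ℝ)]
    simp [g]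
  constructor
  · have := ((Lp.memLp g).integrable (q := 2) (by norm_num)).mul_bdd (c := 1)
      hmem.1 hb
    simpa [mul_comm] using this
  · rw [e1, e2, L2.inner_def]
    refine integral_congr_ae ?_
    filter_upwards [hmem.coeFn_toLp] with x hx
    rw [hx]
    simp [mul_comm]

variable [LocallyCompactSpace S]

theorem exists_cc_approx {f : S → ℝ} (hf : Integrable f m) {ε : ℝ} (hε : 0 < ε) :
    ∃ g : S → ℝ, HasCompactSupport g ∧ (∫ x, ‖f x - g x‖ ∂m) ≤ ε ∧ Continuous g ∧
      Integrable g m := by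
  have key : ∃ g : S → ℝ, eLpNorm (f - g) 1 m ≤ ENNReal.ofReal ε ∧
      (HasCompactSupport g ∧ Continuous g ∧ Integrable g m) := by
    refine MemLp.induction_dense (P := fun g : S → ℝ =>
      HasCompactSupport g ∧ Continuous g ∧ Integrable g m) ENNReal.one_ne_top ?_ ?_ ?_
      (memLp_one_iff_integrable.2 hf) (by simpa using hε)
    · intro c t ht htm δ hδ
      obtain ⟨η, ηpos, hη⟩ := exists_eLpNorm_indicator_le (μ := m) ENNReal.one_ne_top c hδ
      have hη' : ((η / 2 : ℝ≥0) : ℝ≥0∞) ≠ 0 := by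
        have : (0 : ℝ≥0) < η / 2 := half_pos ηpos
        exact_mod_cast this.ne'
      obtain ⟨K, hKt, hK, hKm⟩ := ht.exists_isCompact_sdiff_lt htm.ne hη'
      obtain ⟨V, hV, hVo, -, hVm⟩ := ht.exists_isOpen_sdiff_lt htm.ne hη'
      obtain ⟨a, ha1, ha0, hac, ha⟩ := exists_continuous_one_zero_of_isCompact hK
        hVo.isClosed_compl (Set.disjoint_compl_right_iff_subset.2 (hKt.trans hV))
      refine ⟨fun x => a x * c, ?_, hac.mul_right, a.continuous.mul continuous_const,
        integrable_of_bdd (C := |c|) (a.continuous.mul continuous_const) fun x => ?_⟩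
      · refine (eLpNorm_mono (g := (V \ K).indicator fun _ => c) fun x => ?_).trans (hη _ ?_)
        · by_cases hx : x ∈ K
          · have : a x = 1 := ha1 hx
            simp [hx, hKt hx, this]
          · by_cases hxV : x ∈ V
            · have hm : x ∈ V \ K := ⟨hxV, hx⟩
              rw [Set.indicator_of_mem hm]
              by_cases hxt : x ∈ t
              · have : a x * c - c = -((1 - a x) * c) := by ring
                simp only [Pi.sub_apply, Set.indicator_of_mem hxt]
                rw [this, norm_neg, norm_mul]
                refine mul_le_of_le_one_left (norm_nonneg _) ?_
                rw [Real.norm_of_nonneg] <;> linarith [(ha x).1, (ha x).2]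
              · simp only [Pi.sub_apply, Set.indicator_of_notMem hxt, sub_zero]
                rw [norm_mul, Real.norm_of_nonneg (ha x).1]
                exact mul_le_of_le_one_left (norm_nonneg _) (ha x).2
            · have h0 : a x = 0 := ha0 hxV
              have : x ∉ t := fun h => hxV (hV h)
              simp [h0, this]
        · have : V \ K ⊆ (V \ t) ∪ (t \ K) := fun x hx => by
            by_cases h : x ∈ t
            · exact Or.inr ⟨h, hx.2⟩
            · exact Or.inl ⟨hx.1, h⟩
          refine (measure_mono this).trans ((measure_union_le _ _).trans
            ((add_le_add hVm.le hKm.le).trans_eq ?_))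
          rw [← ENNReal.coe_add, add_halves]
      · rw [norm_mul, Real.norm_of_nonneg (ha x).1]
        exact mul_le_of_le_one_left (norm_nonneg _) (ha x).2
    · rintro f g ⟨h1, h2, h3⟩ ⟨h4, h5, h6⟩
      exact ⟨h1.add h4, h2.add h5, h3.add h6⟩
    · rintro f ⟨-, -, h⟩
      exact h.1
  obtain ⟨g, hg, h1, h2, h3⟩ := key
  refine ⟨g, h1, ?_, h2, h3⟩
  rw [eLpNorm_one_eq_lintegral_enorm] at hg
  change ∫ x, ‖(f - g) x‖ ∂m ≤ ε
  rw [integral_norm_eq_lintegral_enorm (hf.sub h3).1]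
  exact ENNReal.toReal_le_of_le_ofReal hε.le hg

theorem exists_approx (r : M S →L[ℝ] ℝ) {ε : ℝ} (hε : 0 < ε) : ∃ φ : C_c(S, ℝ),
    ∀ (l : Measure S) [IsFiniteMeasure l] [l.Regular], l ≤ m →
      |r (ofM l) - ∫ x, φ x ∂l| ≤ ε := by
  obtain ⟨f, hf, hr⟩ := exists_repr m r
  obtain ⟨g, hgc, hgi, hg, hgm⟩ := exists_cc_approx m hf hε
  refine ⟨⟨⟨g, hg⟩, hgc⟩, fun l _ _ hl => ?_⟩
  change |r (ofM l) - ∫ x, g x ∂l| ≤ ε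
  obtain ⟨hi, he⟩ := hr l hl
  have hb : ∀ᵐ x ∂m, (l.rnDeriv m x).toReal ≤ 1 := by
    filter_upwards [Measure.rnDeriv_le_one_of_le hl] with x hx
    exact ENNReal.toReal_le_of_le_ofReal zero_le_one (by simpa using hx)
  have e2 : ∫ x, g x ∂l = ∫ x, g x * (l.rnDeriv m x).toReal ∂m := by
    rw [← integral_rnDeriv_smul (Measure.absolutelyContinuous_of_le hl)]
    simp [mul_comm]
  have hi2 : Integrable (fun x => g x * (l.rnDeriv m x).toReal) m := by
    refine hgm.mul_bdd (c := 1)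
      (Measure.measurable_rnDeriv l m).ennreal_toReal.aestronglyMeasurable ?_
    filter_upwards [hb] with x hx
    rwa [Real.norm_of_nonneg ENNReal.toReal_nonneg]
  rw [he, e2, ← integral_sub hi hi2]
  refine le_trans ?_ hgi
  rw [← Real.norm_eq_abs]
  refine norm_integral_le_of_norm_le (hf.sub hgm).norm ?_
  filter_upwards [hb] with x hx
  rw [← sub_mul, norm_mul, Real.norm_of_nonneg ENNReal.toReal_nonneg]
  exact mul_le_of_le_one_right (norm_nonneg _) hx

end Density

variable [LocallyCompactSpace S]

/-- Integration of a compactly supported function, as a real functional. -/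
theorem exists_int_functional (φ : C_c(S, ℝ)) : ∃ r : M S →L[ℝ] ℝ,
    ∀ (n : Measure S) [IsFiniteMeasure n] [n.Regular], r (ofM n) = ∫ x, φ x ∂n := by
  obtain ⟨C, hC⟩ := φ.hasCompactSupport.exists_bound_of_continuous φ.continuous
  refine exists_extend (fun n => ∫ x, φ x ∂n) (C := |C|) (fun m n _ _ _ _ => ?_)
    (fun m _ _ => ?_) (abs_nonneg _)
  · exact integral_add_measure (integrable_of_bdd φ.continuous hC)
      (integrable_of_bdd φ.continuous hC)
  · rw [← Real.norm_eq_abs]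
    refine (norm_integral_le_of_norm_le_const (Eventually.of_forall hC)).trans ?_
    exact mul_le_mul_of_nonneg_right (le_abs_self _) measureReal_nonneg

theorem abs_posPart_le (r : M S →L[ℝ] ℝ) (n : Measure S) [IsFiniteMeasure n] :
    |posPart r n| ≤ ‖r‖ * n.real Set.univ := by
  rw [abs_of_nonneg (posPart_nonneg r n)]; exact posPart_le r n

/-- Weak continuity passes from a family of positive measures to a vaguely continuous dominated
family. -/
theorem solid {Y : Type*} [TopologicalSpace Y] (m l : Y → Measure S)
    [∀ y, IsFiniteMeasure (m y)] [∀ y, (m y).Regular] [∀ y, IsFiniteMeasure (l y)]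
    [∀ y, (l y).Regular] (hlm : ∀ y, l y ≤ m y)
    (hm : ∀ r : M S →L[ℝ] ℝ, Continuous fun y => r (ofM (m y)))
    (hl : ∀ φ : C_c(S, ℝ), Continuous fun y => ∫ x, φ x ∂(l y)) (r : M S →L[ℝ] ℝ) :
    Continuous fun y => r (ofM (l y)) := by
  rw [continuous_iff_continuousAt]
  intro y₀
  rw [Metric.continuousAt_iff']
  intro ε hε
  obtain ⟨φ, hφ⟩ := exists_approx (m y₀) r (ε := ε / 8) (by positivity)
  obtain ⟨s, hs⟩ := exists_int_functional φ
  have hp : ∀ t : M S →L[ℝ] ℝ, (∀ (l' : Measure S) [IsFiniteMeasure l'] [l'.Regular], l' ≤ m y₀ →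
      t (ofM l') ≤ ε / 8) → ∀ᶠ y in 𝓝 y₀, t (ofM (l y)) < ε / 4 := by
    intro t ht
    obtain ⟨q, hq⟩ := exists_extend (posPart t) (C := ‖t‖) (fun m n _ _ _ _ => posPart_add t m n)
      (fun m _ _ => abs_posPart_le t m) (norm_nonneg _)
    have h0 : q (ofM (m y₀)) ≤ ε / 8 := by
      rw [hq]
      refine csSup_le ⟨0, lowerVals_zero _ _⟩ ?_
      rintro _ ⟨l', _, _, h, rfl⟩
      exact ht l' h
    filter_upwards [(hm q).continuousAt.eventually_lt (continuousAt_const (y := ε / 4))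
      (by linarith)] with y hy
    exact ((le_posPart t (m y) (l y) (hlm y)).trans_eq (hq (m y)).symm).trans_lt hy
  have e1 := hp (r - s) fun l' _ _ h => by
    have := hφ l' h
    rw [sub_apply, hs]
    exact (le_abs_self _).trans this
  have e2 := hp (s - r) fun l' _ _ h => by
    have := hφ l' h
    rw [abs_sub_comm] at this
    rw [sub_apply, hs]
    exact (le_abs_self _).trans this
  have e3 : ∀ᶠ y in 𝓝 y₀, dist (∫ x, φ x ∂(l y)) (∫ x, φ x ∂(l y₀)) < ε / 4 :=
    Metric.continuousAt_iff'.1 (hl φ).continuousAt _ (by positivity)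
  have e4 := hφ (l y₀) (hlm y₀)
  filter_upwards [e1, e2, e3] with y h1 h2 h3
  rw [sub_apply, hs] at h1 h2
  rw [Real.dist_eq, abs_lt] at *
  rw [abs_le] at e4
  constructor <;> linarith [e4.1, e4.2, h3.1, h3.2]

end Solid

section LS

variable {S : Type*} [TopologicalSpace S] [T2Space S] [MeasurableSpace S] [BorelSpace S]

/-- The point mass `δ_x`. -/
def dirac (x : S) : M S := @ofM S _ _ _ _ (Measure.dirac x) _ (regular_dirac x)

/-- The total variation `|μ|` as an element of `M(S)`. -/
def M.abs (μ : M S) : M S := ofM μ.var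

/-- Continuity of an `M(S)`-valued map for the weak topology `σ(M(S), M(S)*)`. -/
def WeaklyContinuous {Y : Type*} [TopologicalSpace Y] (f : Y → M S) : Prop :=
  Continuous fun y => toWeakSpace ℂ (M S) (f y)

theorem weaklyContinuous_iff {Y : Type*} [TopologicalSpace Y] (f : Y → M S) :
    WeaklyContinuous f ↔ ∀ r : M S →L[ℝ] ℝ, Continuous fun y => r (f y) := by
  constructor
  · intro h r
    let F : StrongDual ℂ (M S) := StrongDual.extendRCLike r
    have h1 : Continuous fun y => F (f y) :=
      (WeakBilin.eval_continuous (topDualPairing ℂ (M S)).flip F).comp h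
    have h2 : ∀ μ, r μ = (F μ).re := fun μ => by
      simp [F, StrongDual.extendRCLike_apply]
    simp only [h2]
    exact Complex.continuous_re.comp h1
  · intro h
    refine WeakBilin.continuous_of_continuous_eval _ fun F => ?_
    change Continuous fun y => F (f y)
    have h1 := h (Complex.reCLM.comp (F.restrictScalars ℝ))
    have h2 := h (Complex.imCLM.comp (F.restrictScalars ℝ))
    have : (fun y => F (f y)) = fun y => (((F (f y)).re : ℝ) : ℂ) + ((F (f y)).im : ℝ) * Complex.I := by
      ext y; rw [Complex.re_add_im]
    rw [this]
    exact (Complex.continuous_ofReal.comp h1).add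
      ((Complex.continuous_ofReal.comp h2).mul continuous_const)

theorem WeaklyContinuous.clm {Y : Type*} [TopologicalSpace Y] {f : Y → M S}
    (h : WeaklyContinuous f) (T : M S →L[ℝ] M S) : WeaklyContinuous fun y => T (f y) := by
  rw [weaklyContinuous_iff] at *
  exact fun r => h (r.comp T)

theorem WeaklyContinuous.add {Y : Type*} [TopologicalSpace Y] {f g : Y → M S}
    (hf : WeaklyContinuous f) (hg : WeaklyContinuous g) :
    WeaklyContinuous fun y => f y + g y := by
  rw [weaklyContinuous_iff] at *
  intro r
  simp only [map_add]
  exact (hf r).add (hg r)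

variable [LocallyCompactSpace S]

section MulOnly
variable [Mul S] [ContinuousMul S]

theorem ofM_mul_ofM (m n : Measure S) [IsFiniteMeasure m] [m.Regular] [IsFiniteMeasure n]
    [n.Regular] : ∃ (k : Measure S) (_ : IsFiniteMeasure k) (_ : k.Regular),
      ofM m * ofM n = ofM k ∧ k Set.univ ≤ m Set.univ * n Set.univ := by
  obtain ⟨k, h1, h2, h3, h4⟩ := exists_conv_pos m n
  refine ⟨k, h1, h2, M.ext_bdd fun f hf C hC => ?_, h3⟩
  rw [conv_spec _ _ hf hC]
  simpa only [int_ofM] using (h4 f hf ⟨C, hC⟩).symm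

theorem norm_ofM_mul_le (m n : Measure S) [IsFiniteMeasure m] [m.Regular] [IsFiniteMeasure n]
    [n.Regular] : ‖ofM m * ofM n‖ ≤ ‖ofM m‖ * ‖ofM n‖ := by
  obtain ⟨k, h1, h2, h3, h4⟩ := ofM_mul_ofM m n
  rw [h3, norm_ofM, norm_ofM, norm_ofM, measureReal_def, measureReal_def, measureReal_def,
    ← ENNReal.toReal_mul]
  exact ENNReal.toReal_mono (ENNReal.mul_ne_top (measure_ne_top _ _) (measure_ne_top _ _)) h4

theorem mul_dirac (n : Measure S) [IsFiniteMeasure n] [n.Regular] (x : S) :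
    ofM n * dirac x = @ofM S _ _ _ _ (n.map (· * x)) inferInstance
      (regular_map (continuous_mul_const x)) := by
  have := regular_dirac x
  have := regular_map (m := n) (continuous_mul_const x)
  refine M.ext_bdd fun f hf C hC => ?_
  rw [conv_spec _ _ hf hC, dirac]
  simp only [int_ofM]
  rw [integral_map (continuous_mul_const x).measurable.aemeasurable hf.aestronglyMeasurable]
  have hc : Continuous fun y => ∫ z, f (z * y) ∂n := by
    simpa only [int_ofM] using continuous_inner (ofM n) hf hC
  rw [integral_dirac' _ _ hc.stronglyMeasurable]

theorem dirac_mul (n : Measure S) [IsFiniteMeasure n] [n.Regular] (x : S) :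
    dirac x * ofM n = @ofM S _ _ _ _ (n.map (x * ·)) inferInstance
      (regular_map (continuous_const_mul x)) := by
  have := regular_dirac x
  have := regular_map (m := n) (continuous_const_mul x)
  refine M.ext_bdd fun f hf C hC => ?_
  rw [conv_spec _ _ hf hC, dirac]
  simp only [int_ofM]
  rw [integral_map (continuous_const_mul x).measurable.aemeasurable hf.aestronglyMeasurable]
  congr 1 with y
  exact integral_dirac' _ _ (hf.comp (continuous_mul_const y)).stronglyMeasurable

/-- Both translation maps of `μ` are weakly continuous. -/
def TransCont (μ : M S) : Prop :=
  WeaklyContinuous (fun x => μ * dirac x) ∧ WeaklyContinuous (fun x => dirac x * μ)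

theorem TransCont.of_le {m n : Measure S} [IsFiniteMeasure m] [m.Regular] [IsFiniteMeasure n]
    [n.Regular] (hle : n ≤ m) (h : TransCont (ofM m)) : TransCont (ofM n) := by
  obtain ⟨h1, h2⟩ := h
  simp only [TransCont, weaklyContinuous_iff, mul_dirac, dirac_mul] at *
  have i1 : ∀ x : S, (m.map (· * x)).Regular := fun x => regular_map (continuous_mul_const x)
  have i2 : ∀ x : S, (n.map (· * x)).Regular := fun x => regular_map (continuous_mul_const x)
  have i3 : ∀ x : S, (m.map (x * ·)).Regular := fun x => regular_map (continuous_const_mul x)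
  have i4 : ∀ x : S, (n.map (x * ·)).Regular := fun x => regular_map (continuous_const_mul x)
  constructor
  · refine solid (fun x => m.map (· * x)) (fun x => n.map (· * x))
      (fun x => Measure.map_mono hle (continuous_mul_const x).measurable) h1 fun φ => ?_
    obtain ⟨C, hC⟩ := φ.hasCompactSupport.exists_bound_of_continuous φ.continuous
    have e : ∀ x, ∫ z, φ z ∂(n.map (· * x)) = ∫ z, φ (z * x) ∂n := fun x =>
      integral_map (continuous_mul_const x).measurable.aemeasurable
        φ.continuous.aestronglyMeasurable
    simp only [e]
    exact continuous_param n (H := fun x z => φ (z * x))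
      (φ.continuous.comp (continuous_snd.mul continuous_fst)) fun _ _ => hC _
  · refine solid (fun x => m.map (x * ·)) (fun x => n.map (x * ·))
      (fun x => Measure.map_mono hle (continuous_const_mul x).measurable) h2 fun φ => ?_
    obtain ⟨C, hC⟩ := φ.hasCompactSupport.exists_bound_of_continuous φ.continuous
    have e : ∀ x, ∫ z, φ z ∂(n.map (x * ·)) = ∫ z, φ (x * z) ∂n := fun x =>
      integral_map (continuous_const_mul x).measurable.aemeasurable
        φ.continuous.aestronglyMeasurable
    simp only [e]
    exact continuous_param n (H := fun x z => φ (x * z))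
      (φ.continuous.comp (continuous_fst.mul continuous_snd)) fun _ _ => hC _

end MulOnly

section Semi
variable [Semigroup S] [ContinuousMul S]

theorem norm_mul_le_16 (μ ν : M S) : ‖μ * ν‖ ≤ 16 * ‖μ‖ * ‖ν‖ := by
  have tri : ∀ (a b c d : M S), ‖a - b + Complex.I • (c - d)‖ ≤ ‖a‖ + ‖b‖ + (‖c‖ + ‖d‖) := by
    intro a b c d
    refine (norm_add_le _ _).trans (add_le_add (norm_sub_le _ _) ?_)
    rw [norm_smul, Complex.norm_I, one_mul]
    exact norm_sub_le _ _
  obtain ⟨m, hf, hr, hle, he⟩ := exists_decomp_M μ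
  obtain ⟨n, hf', hr', hle', he'⟩ := exists_decomp_M ν
  have bm : ∀ i, ‖ofM (m i)‖ ≤ ‖μ‖ := fun i => by
    rw [norm_ofM]; exact ENNReal.toReal_mono (measure_ne_top _ _) (hle i _)
  have bn : ∀ i, ‖ofM (n i)‖ ≤ ‖ν‖ := fun i => by
    rw [norm_ofM]; exact ENNReal.toReal_mono (measure_ne_top _ _) (hle' i _)
  have b1 : ∀ i j, ‖ofM (m i) * ofM (n j)‖ ≤ ‖μ‖ * ‖ν‖ := fun i j =>
    (norm_ofM_mul_le _ _).trans (mul_le_mul (bm i) (bn j) (norm_nonneg _) (norm_nonneg _))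
  have b2 : ∀ i, ‖ofM (m i) * ν‖ ≤ 4 * (‖μ‖ * ‖ν‖) := fun i => by
    have e : ofM (m i) * ν = ofM (m i) * ofM (n 0) - ofM (m i) * ofM (n 1) +
        Complex.I • (ofM (m i) * ofM (n 2) - ofM (m i) * ofM (n 3)) := by
      conv_lhs => rw [he']
      rw [mul_add, mul_sub, mul_smul_comm, mul_sub]
    rw [e]
    refine (tri _ _ _ _).trans ?_
    linarith [b1 i 0, b1 i 1, b1 i 2, b1 i 3]
  have e : μ * ν = ofM (m 0) * ν - ofM (m 1) * ν +
      Complex.I • (ofM (m 2) * ν - ofM (m 3) * ν) := by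
    conv_lhs => rw [he]
    rw [add_mul, sub_mul, smul_mul_assoc, sub_mul]
  rw [e]
  refine (tri _ _ _ _).trans ?_
  linarith [b2 0, b2 1, b2 2, b2 3]

/-- Left convolution as a real operator. -/
def mulLeftCLM (κ : M S) : M S →L[ℝ] M S :=
  (AddMonoidHom.mulLeft κ).toRealLinearMap
    (AddMonoidHomClass.continuous_of_bound _ (16 * ‖κ‖) fun ν => norm_mul_le_16 κ ν)

/-- Right convolution as a real operator. -/
def mulRightCLM (κ : M S) : M S →L[ℝ] M S :=
  (AddMonoidHom.mulRight κ).toRealLinearMap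
    (AddMonoidHomClass.continuous_of_bound _ (16 * ‖κ‖) fun ν =>
      (norm_mul_le_16 ν κ).trans_eq (by ring))

theorem TransCont.mul {μ ν : M S} (hμ : TransCont μ) (hν : TransCont ν) : TransCont (μ * ν) := by
  constructor
  · simp only [mul_assoc]
    exact hν.1.clm (mulLeftCLM μ)
  · simp only [← mul_assoc]
    exact hμ.2.clm (mulRightCLM ν)

theorem TransCont.add {μ ν : M S} (hμ : TransCont μ) (hν : TransCont ν) : TransCont (μ + ν) := by
  constructor
  · simp only [add_mul]
    exact hμ.1.add hν.1
  · simp only [mul_add]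
    exact hμ.2.add hν.2

theorem TransCont.smul {μ : M S} (c : ℝ≥0) (hμ : TransCont μ) : TransCont ((c : ℂ) • μ) := by
  have hc : WeaklyContinuous fun x => (c : ℂ) • (μ * dirac x) :=
    hμ.1.clm ((c : ℝ) • ContinuousLinearMap.id ℝ (M S))
  have hd : WeaklyContinuous fun x => (c : ℂ) • (dirac x * μ) :=
    hμ.2.clm ((c : ℝ) • ContinuousLinearMap.id ℝ (M S))
  constructor
  · simpa only [smul_mul_assoc] using hc
  · simpa only [mul_smul_comm] using hd

theorem smul_ofM (c : ℝ≥0) (n : Measure S) [IsFiniteMeasure n] [n.Regular] :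
    ofM (c • n) = (c : ℂ) • ofM n := by
  refine Subtype.ext (VectorMeasure.ext fun A hA => ?_)
  change toC (c • n) A = (c : ℂ) * toC n A
  rw [toC_apply _ hA, toC_apply _ hA, measureReal_def, measureReal_def, Measure.smul_apply,
    ENNReal.smul_def, smul_eq_mul, ENNReal.toReal_mul]
  push_cast
  rfl

variable (S) in
/-- The measures `μ` for which `x ↦ |μ| * δ_x` and `x ↦ δ_x * |μ|` are weakly continuous. -/
def LSubmodule : Submodule ℂ (M S) where
  carrier := {μ | TransCont μ.abs}
  zero_mem' := by
    have h : (0 : M S).abs = 0 := by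
      rw [M.abs, ← norm_eq_zero, norm_ofM, ← norm_def, norm_zero]
    change TransCont (0 : M S).abs
    rw [h]
    constructor <;> simp only [zero_mul, mul_zero] <;> exact continuous_const
  add_mem' := by
    intro μ ν hμ hν
    have := regular_add (m := μ.var) (n := ν.var)
    refine TransCont.of_le (var_add_le μ ν) ?_
    rw [ofM_add]
    exact TransCont.add hμ hν
  smul_mem' := by
    intro c μ hμ
    change TransCont (ofM (c • μ).var)
    rw [ofM_congr (var_smul c μ), smul_ofM]
    exact TransCont.smul _ hμ

theorem ofM_mem_LSubmodule {n : Measure S} [IsFiniteMeasure n] [n.Regular] :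
    ofM n ∈ LSubmodule S ↔ TransCont (ofM n) := by
  change TransCont (ofM (ofM n).var) ↔ _
  rw [ofM_congr (var_ofM n)]

theorem LSubmodule_ind {P : M S → Prop}
    (pos : ∀ (n : Measure S) [IsFiniteMeasure n] [n.Regular], TransCont (ofM n) → P (ofM n))
    (add : ∀ μ ν, P μ → P ν → P (μ + ν)) (smul : ∀ (c : ℂ) μ, P μ → P (c • μ)) {μ : M S}
    (hμ : μ ∈ LSubmodule S) : P μ := by
  obtain ⟨m, hf, hr, hle, he⟩ := exists_decomp_M μ
  rw [he]
  have hp : ∀ i, P (ofM (m i)) := fun i => pos _ (TransCont.of_le (hle i) hμ)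
  have hsub : ∀ μ ν, P μ → P ν → P (μ - ν) := fun μ ν h1 h2 => by
    rw [sub_eq_add_neg, ← neg_one_smul ℂ ν]
    exact add _ _ h1 (smul _ _ h2)
  exact add _ _ (hsub _ _ (hp _) (hp _)) (smul _ _ (hsub _ _ (hp _) (hp _)))

theorem LSubmodule_mul {μ ν : M S} (hμ : μ ∈ LSubmodule S) (hν : ν ∈ LSubmodule S) :
    μ * ν ∈ LSubmodule S := by
  refine LSubmodule_ind (P := fun μ => μ * ν ∈ LSubmodule S) (fun m _ _ hm => ?_)
    (fun μ₁ μ₂ h1 h2 => ?_) (fun c μ h => ?_) hμ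
  · refine LSubmodule_ind (P := fun ν => ofM m * ν ∈ LSubmodule S) (fun n _ _ hn => ?_)
      (fun μ₁ μ₂ h1 h2 => ?_) (fun c μ h => ?_) hν
    · obtain ⟨k, h1, h2, h3, h4⟩ := ofM_mul_ofM m n
      have := hm.mul hn
      rw [h3] at this ⊢
      exact ofM_mem_LSubmodule.2 this
    · rw [mul_add]; exact add_mem h1 h2
    · rw [mul_smul_comm]; exact Submodule.smul_mem _ _ h
  · rw [add_mul]; exact add_mem h1 h2
  · rw [smul_mul_assoc]; exact Submodule.smul_mem _ _ h

end Semi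

section StarSemi
variable [Semigroup S] [ContinuousMul S] [StarMul S] [ContinuousStar S]

theorem star_dirac (x : S) : star (dirac x) = dirac (star x) := by
  have := regular_dirac x
  have := regular_dirac (star x)
  rw [dirac, star_ofM]
  have e : (Measure.dirac x).map star = Measure.dirac (star x) :=
    Measure.map_dirac' measurable_star' x
  have := regular_map (m := Measure.dirac x) (continuous_star (R := S))
  exact ofM_congr e

/-- The involution as a real operator. -/
def starCLM : M S →L[ℝ] M S :=
  (starAddEquiv : M S ≃+ M S).toAddMonoidHom.toRealLinearMap
    (AddMonoidHomClass.continuous_of_bound _ 1 fun ν => by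
      rw [one_mul]; exact (norm_star' ν).le)

theorem WeaklyContinuous.comp {Y Z : Type*} [TopologicalSpace Y] [TopologicalSpace Z]
    {f : Y → M S} (h : WeaklyContinuous f) {g : Z → Y} (hg : Continuous g) :
    WeaklyContinuous fun z => f (g z) :=
  Continuous.comp (g := fun y => toWeakSpace ℂ (M S) (f y)) h hg

theorem TransCont.star {μ : M S} (hμ : TransCont μ) : TransCont (star μ) := by
  constructor
  · have h : WeaklyContinuous fun x => Star.star (dirac (Star.star x) * μ) :=
      (hμ.2.clm starCLM).comp continuous_star
    simpa only [star_mul, star_dirac, star_star] using h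
  · have h : WeaklyContinuous fun x => Star.star (μ * dirac (Star.star x)) :=
      (hμ.1.clm starCLM).comp continuous_star
    simpa only [star_mul, star_dirac, star_star] using h

variable (S) in
/-- `L(S)`: the measures `μ ∈ M(S)` for which `x ↦ |μ| * δ_x` and `x ↦ δ_x * |μ|` are continuous
from `S` to `M(S)` with its weak topology; it is a `*`-subalgebra of `M(S)`. -/
def L : NonUnitalStarSubalgebra ℂ (M S) where
  carrier := {μ | WeaklyContinuous (fun x => μ.abs * dirac x) ∧
    WeaklyContinuous (fun x => dirac x * μ.abs)}
  zero_mem' := (LSubmodule S).zero_mem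
  add_mem' h1 h2 := (LSubmodule S).add_mem h1 h2
  smul_mem' c _ h := (LSubmodule S).smul_mem c h
  mul_mem' h1 h2 := LSubmodule_mul h1 h2
  star_mem' := by
    intro μ hμ
    have e : (star μ).abs = star μ.abs := by
      have := regular_map (m := μ.var) (continuous_star (R := S))
      rw [M.abs, M.abs, star_ofM]
      exact ofM_congr (var_star μ)
    change TransCont (star μ).abs
    rw [e]
    exact TransCont.star hμ

end StarSemi
end LS

section Rep

universe u

variable (S : Type u) [TopologicalSpace S] [Semigroup S] [StarMul S]

/-- An element of `Σ(S)`: a `*`-representation `π` of `S` on a Hilbert space `H` with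
`‖π(x)‖ ≤ 1` for all `x` and with `x ↦ ⟨π(x)ξ, η⟩` continuous for all `ξ, η ∈ H`. It need not be
non-degenerate, nor need it preserve an identity. -/
structure StarRep where
  /-- The Hilbert space. -/
  H : Type u
  [normed : NormedAddCommGroup H]
  [innerProd : InnerProductSpace ℂ H]
  [complete : CompleteSpace H]
  /-- The operators of the representation. -/
  toFun : S → H →L[ℂ] H
  map_mul : ∀ x y, toFun (x * y) = toFun x * toFun y
  map_star : ∀ x, toFun (star x) = ContinuousLinearMap.adjoint (toFun x)
  norm_le_one : ∀ x, ‖toFun x‖ ≤ 1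
  weak_continuous : ∀ ξ η : H, Continuous fun x => inner ℂ η (toFun x ξ)

instance (π : StarRep S) : NormedAddCommGroup π.H := π.normed
instance (π : StarRep S) : InnerProductSpace ℂ π.H := π.innerProd
instance (π : StarRep S) : CompleteSpace π.H := π.complete

variable {S}
variable [T2Space S] [MeasurableSpace S] [BorelSpace S]

namespace StarRep

variable (π : StarRep S)

theorem bound (ξ η : π.H) (x : S) : ‖inner ℂ η (π.toFun x ξ)‖ ≤ ‖η‖ * ‖ξ‖ := by
  refine (norm_inner_le_norm _ _).trans (mul_le_mul_of_nonneg_left ?_ (norm_nonneg _))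
  exact ((π.toFun x).le_opNorm ξ).trans
    (mul_le_of_le_one_left (norm_nonneg _) (π.norm_le_one x))

/-- The sesquilinear form `(η, ξ) ↦ ∫ ⟨π(x)ξ, η⟩ dμ(x)`. -/
def form (μ : M S) : π.H →L⋆[ℂ] π.H →L[ℂ] ℂ :=
  LinearMap.mkContinuous₂
    (LinearMap.mk₂'ₛₗ (starRingEnd ℂ) (RingHom.id ℂ)
      (fun η ξ => μ.int fun x => inner ℂ η (π.toFun x ξ))
      (fun η₁ η₂ ξ => by
        simp only [inner_add_left]
        exact int_fun_add μ (π.weak_continuous _ _) (π.bound _ _) (π.weak_continuous _ _)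
          (π.bound _ _))
      (fun c η ξ => by
        simp only [inner_smul_left]
        exact int_fun_smul μ _ (π.weak_continuous _ _) (π.bound _ _))
      (fun η ξ₁ ξ₂ => by
        simp only [map_add, inner_add_right]
        exact int_fun_add μ (π.weak_continuous _ _) (π.bound _ _) (π.weak_continuous _ _)
          (π.bound _ _))
      (fun c η ξ => by
        simp only [map_smul, inner_smul_right]
        exact int_fun_smul μ _ (π.weak_continuous _ _) (π.bound _ _)))
    ‖μ‖ fun η ξ => (norm_int_le μ (π.bound ξ η)).trans_eq (by ring)

/-- The operator `π̃(μ)`, with `⟨π̃(μ)ξ, η⟩ = ∫ ⟨π(x)ξ, η⟩ dμ(x)`; see `inner_tilde`. -/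
def tilde (μ : M S) : π.H →L[ℂ] π.H :=
  ContinuousLinearMap.adjoint (InnerProductSpace.continuousLinearMapOfBilin (π.form μ))

theorem inner_tilde (μ : M S) (ξ η : π.H) :
    inner ℂ η (π.tilde μ ξ) = μ.int fun x => inner ℂ η (π.toFun x ξ) := by
  rw [tilde, ContinuousLinearMap.adjoint_inner_right,
    InnerProductSpace.continuousLinearMapOfBilin_apply]
  rfl

theorem norm_tilde_le (μ : M S) : ‖π.tilde μ‖ ≤ ‖μ‖ := by
  refine ContinuousLinearMap.opNorm_le_bound _ (norm_nonneg _) fun ξ => ?_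
  have h : ‖inner ℂ (π.tilde μ ξ) (π.tilde μ ξ)‖ ≤ ‖π.tilde μ ξ‖ * ‖ξ‖ * ‖μ‖ := by
    rw [inner_tilde]
    exact norm_int_le μ (π.bound ξ _)
  rw [inner_self_eq_norm_sq_to_K] at h
  simp only [norm_pow, RCLike.norm_ofReal, abs_norm] at h
  by_cases h0 : ‖π.tilde μ ξ‖ = 0
  · rw [h0]; positivity
  · have hp : 0 < ‖π.tilde μ ξ‖ := lt_of_le_of_ne (norm_nonneg _) (Ne.symm h0)
    nlinarith

theorem tilde_ext {A B : π.H →L[ℂ] π.H} (h : ∀ ξ η, inner ℂ η (A ξ) = inner ℂ η (B ξ)) :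
    A = B :=
  ContinuousLinearMap.ext fun ξ => ext_inner_left ℂ fun η => h ξ η

theorem tilde_add (μ ν : M S) : π.tilde (μ + ν) = π.tilde μ + π.tilde ν := by
  refine π.tilde_ext fun ξ η => ?_
  rw [inner_tilde, int_add μ ν (π.weak_continuous ξ η) (π.bound ξ η), add_apply,
    inner_add_right, inner_tilde, inner_tilde]

theorem tilde_smul (c : ℂ) (μ : M S) : π.tilde (c • μ) = c • π.tilde μ := by
  refine π.tilde_ext fun ξ η => ?_
  rw [inner_tilde, int_smul c μ (π.weak_continuous ξ η) (π.bound ξ η), smul_apply,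
    inner_smul_right, inner_tilde]

theorem tilde_mul [LocallyCompactSpace S] [ContinuousMul S] (μ ν : M S) :
    π.tilde (μ * ν) = π.tilde μ * π.tilde ν := by
  refine π.tilde_ext fun ξ η => ?_
  rw [inner_tilde, conv_spec μ ν (π.weak_continuous ξ η) (π.bound ξ η)]
  have h : ∀ y, (μ.int fun x => inner ℂ η (π.toFun (x * y) ξ)) =
      inner ℂ (ContinuousLinearMap.adjoint (π.tilde μ) η) (π.toFun y ξ) := fun y => by
    rw [ContinuousLinearMap.adjoint_inner_left, inner_tilde]
    simp only [π.map_mul, mul_apply_eq_comp]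
  simp only [h]
  rw [← inner_tilde, ContinuousLinearMap.adjoint_inner_left, mul_apply_eq_comp]

theorem tilde_star [LocallyCompactSpace S] [ContinuousStar S] (μ : M S) :
    π.tilde (star μ) = star (π.tilde μ) := by
  refine π.tilde_ext fun ξ η => ?_
  rw [inner_tilde, int_star μ (π.weak_continuous ξ η) (π.bound ξ η)]
  have h : ∀ x, conj (inner ℂ η (π.toFun (star x) ξ)) = inner ℂ ξ (π.toFun x η) := fun x => by
    rw [inner_conj_symm, π.map_star, ContinuousLinearMap.adjoint_inner_left]
  simp only [h]
  rw [← inner_tilde, inner_conj_symm, ContinuousLinearMap.star_eq_adjoint,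
    ContinuousLinearMap.adjoint_inner_right]

end StarRep

section CStar

variable [LocallyCompactSpace S] [ContinuousMul S] [ContinuousStar S]

/-- The seminorm `‖μ‖_ρ = sup_{π ∈ ρ} ‖π̃(μ)‖` on `M(S)`; it is `0` for empty `ρ`. -/
def rhoNorm (ρ : Set (StarRep S)) (μ : M S) : ℝ := ⨆ π : ρ, ‖π.1.tilde μ‖

/-- The C*-algebra of bounded families of operators indexed by `ρ`, with the supremum norm. -/
def Ops (ρ : Set (StarRep S)) : Type _ := lp (fun π : ρ => π.1.H →L[ℂ] π.1.H) ∞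

instance (ρ : Set (StarRep S)) : NonUnitalCStarAlgebra (Ops ρ) :=
  inferInstanceAs (NonUnitalCStarAlgebra (lp (fun π : ρ => π.1.H →L[ℂ] π.1.H) ∞))

/-- The `*`-homomorphism `μ ↦ (π̃(μ))_{π ∈ ρ}` from `L(S)` to the bounded families of
operators. -/
def family (ρ : Set (StarRep S)) :
    L S →⋆ₙₐ[ℂ] Ops ρ where
  toFun μ := ⟨fun π => π.1.tilde μ, memℓp_infty ⟨‖(μ : M S)‖, by
    rintro _ ⟨π, rfl⟩
    exact π.1.norm_tilde_le _⟩⟩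
  map_smul' c μ := lp.ext (funext fun π => π.1.tilde_smul c μ)
  map_zero' := lp.ext (funext fun π => by
    have := π.1.tilde_smul 0 (0 : M S)
    rw [zero_smul, zero_smul] at this
    exact this)
  map_add' μ ν := lp.ext (funext fun π => π.1.tilde_add μ ν)
  map_mul' μ ν := lp.ext (funext fun π => π.1.tilde_mul μ ν)
  map_star' μ := lp.ext (funext fun π => π.1.tilde_star μ)

theorem family_apply (ρ : Set (StarRep S)) (μ : L S) (π : ρ) :
    (family ρ μ).1 π = π.1.tilde μ := rfl

theorem norm_family (ρ : Set (StarRep S)) (μ : L S) : ‖family ρ μ‖ = rhoNorm ρ μ :=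
  lp.norm_eq_ciSup _

/-- `N_ρ = {μ ∈ L(S) : ‖μ‖_ρ = 0}`. -/
def N (ρ : Set (StarRep S)) : Submodule ℂ (L S) where
  carrier := {μ | rhoNorm ρ μ = 0}
  zero_mem' := by
    change rhoNorm ρ ((0 : L S) : M S) = 0
    rw [← norm_family, map_zero, norm_zero]
  add_mem' := by
    intro μ ν hμ hν
    change rhoNorm ρ (μ : M S) = 0 at hμ
    change rhoNorm ρ (ν : M S) = 0 at hν
    change rhoNorm ρ ((μ + ν : L S) : M S) = 0
    rw [← norm_family, norm_eq_zero] at *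
    rw [map_add, hμ, hν, add_zero]
  smul_mem' := by
    intro c μ hμ
    change rhoNorm ρ (μ : M S) = 0 at hμ
    change rhoNorm ρ ((c • μ : L S) : M S) = 0
    rw [← norm_family, norm_eq_zero] at *
    rw [map_smul, hμ, smul_zero]

/-- The C*-algebra `C*_ρ(S)`: the completion of `L(S) / N_ρ` in the norm `‖μ + N_ρ‖ = ‖μ‖_ρ`,
realized as the closure of the image of `L(S)` in the bounded families of operators indexed by
`ρ`. It is complete, and `embed` identifies `L(S) / N_ρ` isometrically with a dense subalgebra;
see `norm_embed` and `denseRange_embed`. -/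
def CStarRho (ρ : Set (StarRep S)) : Type _ :=
  (NonUnitalStarAlgHom.range (family ρ)).topologicalClosure

instance (ρ : Set (StarRep S)) : NonUnitalCStarAlgebra (CStarRho ρ) :=
  haveI : IsClosed ((NonUnitalStarAlgHom.range (family ρ)).topologicalClosure :
      Set (Ops ρ)) :=
    NonUnitalStarSubalgebra.isClosed_topologicalClosure _
  inferInstanceAs
    (NonUnitalCStarAlgebra (NonUnitalStarAlgHom.range (family ρ)).topologicalClosure)

/-- The canonical `*`-homomorphism `L(S) → C*_ρ(S)`. -/
def toCStarRho (ρ : Set (StarRep S)) : L S →⋆ₙₐ[ℂ] CStarRho ρ where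
  toFun μ := ⟨family ρ μ, NonUnitalStarSubalgebra.le_topologicalClosure _ ⟨μ, rfl⟩⟩
  map_smul' c μ := Subtype.ext (map_smul (family ρ) c μ)
  map_zero' := Subtype.ext (map_zero (family ρ))
  map_add' μ ν := Subtype.ext (map_add (family ρ) μ ν)
  map_mul' μ ν := Subtype.ext (map_mul (family ρ) μ ν)
  map_star' μ := Subtype.ext (map_star (family ρ) μ)

theorem norm_toCStarRho (ρ : Set (StarRep S)) (μ : L S) : ‖toCStarRho ρ μ‖ = rhoNorm ρ μ :=
  norm_family ρ μ

/-- The inclusion of `L(S) / N_ρ` in its completion `C*_ρ(S)`. -/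
def embed (ρ : Set (StarRep S)) : (L S ⧸ N ρ) →ₗ[ℂ] CStarRho ρ :=
  (N ρ).liftQ (toCStarRho ρ : L S →ₗ[ℂ] CStarRho ρ) fun μ hμ => by
    change toCStarRho ρ μ = 0
    rw [← norm_eq_zero, norm_toCStarRho]
    exact hμ

theorem embed_mk (ρ : Set (StarRep S)) (μ : L S) :
    embed ρ (Submodule.Quotient.mk μ) = toCStarRho ρ μ := rfl

theorem norm_embed (ρ : Set (StarRep S)) (μ : L S) :
    ‖embed ρ (Submodule.Quotient.mk μ)‖ = rhoNorm ρ μ := norm_toCStarRho ρ μ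

theorem embed_injective (ρ : Set (StarRep S)) : Function.Injective (embed ρ) := by
  rw [injective_iff_map_eq_zero]
  intro q
  obtain ⟨μ, rfl⟩ := Submodule.Quotient.mk_surjective _ q
  intro h
  rw [Submodule.Quotient.mk_eq_zero]
  change rhoNorm ρ (μ : M S) = 0
  rw [← norm_embed, h, norm_zero]

theorem denseRange_toCStarRho (ρ : Set (StarRep S)) : DenseRange (toCStarRho ρ) := by
  intro g
  have hg : g.1 ∈ closure (Set.range (family ρ)) := by
    have h : g.1 ∈ closure (NonUnitalStarAlgHom.range (family ρ) : Set (Ops ρ)) := g.2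
    rwa [NonUnitalStarAlgHom.coe_range] at h
  have hi : IsInducing (fun g : CStarRho ρ => (g.1 : Ops ρ)) := IsInducing.subtypeVal
  rw [hi.closure_eq_preimage_closure_image, Set.mem_preimage, ← Set.range_comp]
  exact hg

theorem denseRange_embed (ρ : Set (StarRep S)) : DenseRange (embed ρ) := by
  refine (denseRange_toCStarRho ρ).mono ?_
  rintro _ ⟨μ, rfl⟩
  exact ⟨Submodule.Quotient.mk μ, rfl⟩

variable (S) in
/-- The full semigroup C*-algebra `C*(S) = C*_Σ(S)`. -/
abbrev CStar : Type _ := CStarRho (Set.univ : Set (StarRep S))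

variable (S) in
/-- The canonical map `L(S) → C*(S)`. -/
abbrev toCStar : L S →⋆ₙₐ[ℂ] CStar S := toCStarRho Set.univ

/-- The extension of `π̃` to a `*`-representation of `C*(S)`; see `ext_toCStar`. -/
def StarRep.ext (π : StarRep S) : CStar S →⋆ₙₐ[ℂ] (π.H →L[ℂ] π.H) where
  toFun g := g.1.1 ⟨π, trivial⟩
  map_smul' _ _ := rfl
  map_zero' := rfl
  map_add' _ _ := rfl
  map_mul' _ _ := rfl
  map_star' _ := rfl

theorem StarRep.ext_toCStar (π : StarRep S) (μ : L S) : π.ext (toCStar S μ) = π.tilde μ := rfl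

theorem StarRep.norm_ext_le (π : StarRep S) (g : CStar S) : ‖π.ext g‖ ≤ ‖g‖ :=
  lp.norm_apply_le_norm (by simp) g.1 ⟨π, trivial⟩

/-- `N'_ρ = ⋂_{π ∈ ρ} ker π̃`, a subspace of `C*(S)`. -/
def N' (ρ : Set (StarRep S)) : Submodule ℂ (CStar S) :=
  ⨅ π ∈ ρ, LinearMap.ker (π.ext : CStar S →ₗ[ℂ] (π.H →L[ℂ] π.H))

theorem mem_N' (ρ : Set (StarRep S)) (g : CStar S) : g ∈ N' ρ ↔ ∀ π ∈ ρ, π.ext g = 0 := by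
  simp only [N', Submodule.mem_iInf]
  rfl

end CStar
end Rep

end FoundationSemigroup

end

/-!
For `ρ ⊆ σ`, forgetting the representations outside `ρ` maps bounded families of operators indexed
by `σ` to those indexed by `ρ`, compatibly with the images of `L(S)`. It therefore restricts to
`φ : C*_σ(S) → C*_ρ(S)`, whose kernel consists of the elements killed by every `π ∈ ρ` and whose
range contains the dense image of `L(S)`.

That the induced map on the quotient is isometric is a fact about any `*`-homomorphism `φ` of
C*-algebras: every `a` agrees modulo `ker φ` with some `b` such that `‖b‖ ≤ ‖φ a‖`. With
`c = ‖φ a‖²`, one takes `b = a (1 - k)`, where `k = f(a*a)` for a function `f` which vanishes on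
`(-∞, c]`, so that `φ k = f(φ(a)*φ(a)) = 0`, and for which `t (1 - f t)² ≤ c`, so that
`‖b‖² = ‖b*b‖ ≤ c`. An isometric image of a complete space being closed, `φ` is then onto.
-/

noncomputable section

namespace FoundationSemigroup

section CStarAlgebra

open scoped CStarAlgebra

variable {A B : Type*} [NonUnitalCStarAlgebra A] [NonUnitalCStarAlgebra B]

theorem cfcₙ_eq_zero_of_forall_abs_le_norm {a : A} (ha : IsSelfAdjoint a) {f : ℝ → ℝ}
    (hf : ∀ t, |t| ≤ ‖a‖ → f t = 0) : cfcₙ f a = 0 := by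
  rw [← cfcₙ_zero (R := ℝ) a]
  exact cfcₙ_congr fun t ht =>
    hf t (NonUnitalIsometricContinuousFunctionalCalculus.norm_quasispectrum_le a ht ha)

theorem star_mul_self_sub_mul_cfcₙ (a : A) {f : ℝ → ℝ} (hf : Continuous f) (hf₀ : f 0 = 0) :
    star (a - a * cfcₙ f (star a * a)) * (a - a * cfcₙ f (star a * a)) =
      cfcₙ (fun t => t * (1 - f t) ^ 2) (star a * a) := by
  set p : A := star a * a with hp
  have hsa : IsSelfAdjoint p := IsSelfAdjoint.star_mul_self a
  have hid : cfcₙ (fun t : ℝ => t) p = p := cfcₙ_id' ℝ p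
  have hpk : cfcₙ (fun t => t * f t) p = p * cfcₙ f p := by
    rw [cfcₙ_mul (fun t => t) f p, hid]
  have hkpk : cfcₙ (fun t => f t * (t * f t)) p = cfcₙ f p * (p * cfcₙ f p) := by
    rw [cfcₙ_mul f (fun t => t * f t) p, hpk]
  have hkp : cfcₙ (fun t => f t * t) p = cfcₙ f p * p := by
    rw [cfcₙ_mul f (fun t => t) p, hid]
  calc star (a - a * cfcₙ f p) * (a - a * cfcₙ f p)
      = p - p * cfcₙ f p - (cfcₙ f p * p - cfcₙ f p * (p * cfcₙ f p)) := by
        rw [star_sub, star_mul, (IsSelfAdjoint.cfcₙ : IsSelfAdjoint (cfcₙ f p)).star_eq, hp]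
        noncomm_ring
    _ = cfcₙ (fun t => t - t * f t - (f t * t - f t * (t * f t))) p := by
        rw [cfcₙ_sub (fun t => t - t * f t) (fun t => f t * t - f t * (t * f t)) p,
          cfcₙ_sub (fun t => t) (fun t => t * f t) p,
          cfcₙ_sub (fun t => f t * t) (fun t => f t * (t * f t)) p, hid, hpk, hkp, hkpk]
    _ = cfcₙ (fun t => t * (1 - f t) ^ 2) p := by
        congr 1
        funext t
        ring

/-- The fraction by which `t` has to be reduced in order to come down to the level `c > 0`; it is
`0` for `t ≤ c`. -/
def excess (c t : ℝ) : ℝ := 1 - c / max t c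

variable {c : ℝ}

theorem continuous_excess (hc : 0 < c) : Continuous (excess c) :=
  continuous_const.sub <| continuous_const.div (by fun_prop) fun t => (lt_max_of_lt_right hc).ne'

theorem excess_eq_zero (hc : 0 < c) {t : ℝ} (ht : t ≤ c) : excess c t = 0 := by
  rw [excess, max_eq_right ht, div_self hc.ne', sub_self]

theorem mul_one_sub_excess_sq_le (hc : 0 < c) (t : ℝ) : t * (1 - excess c t) ^ 2 ≤ c := by
  have : 0 < max t c := lt_max_of_lt_right hc
  rw [excess, sub_sub_cancel, div_pow, mul_div_assoc', div_le_iff₀ (by positivity)]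
  calc t * c ^ 2 = c * (t * c) := by ring
    _ ≤ c * (max t c * max t c) := by
        gcongr
        exacts [le_max_left t c, le_max_right t c]
    _ = c * max t c ^ 2 := by rw [sq]

theorem norm_sub_mul_cfcₙ_excess_sq_le (hc : 0 < c) (a : A) :
    ‖a - a * cfcₙ (excess c) (star a * a)‖ ^ 2 ≤ c := by
  rw [sq, ← CStarRing.norm_star_mul_self,
    star_mul_self_sub_mul_cfcₙ a (continuous_excess hc) (excess_eq_zero hc hc.le)]
  let _ := CStarAlgebra.spectralOrder A
  have _ := CStarAlgebra.spectralOrderedRing A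
  refine norm_cfcₙ_le fun t ht => ?_
  have ht₀ : 0 ≤ t := quasispectrum_nonneg_of_nonneg _ (star_mul_self_nonneg a) t ht
  rw [Real.norm_of_nonneg (by positivity)]
  exact mul_one_sub_excess_sq_le hc t

theorem map_cfcₙ_excess_eq_zero (φ : A →⋆ₙₐ[ℂ] B) {a : A} (hc : 0 < c) (ha : ‖φ a‖ ^ 2 ≤ c) :
    φ (cfcₙ (excess c) (star a * a)) = 0 := by
  have hsa : IsSelfAdjoint (star a * a) := IsSelfAdjoint.star_mul_self a
  rw [φ.map_cfcₙ (excess c) (star a * a) (continuous_excess hc).continuousOn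
    (excess_eq_zero hc hc.le) (map_continuous φ) hsa (hsa.map φ)]
  refine cfcₙ_eq_zero_of_forall_abs_le_norm (hsa.map φ) fun t ht => excess_eq_zero hc ?_
  calc t ≤ ‖φ (star a * a)‖ := (le_abs_self t).trans ht
    _ = ‖φ a‖ ^ 2 := by rw [map_mul, map_star, CStarRing.norm_star_mul_self, sq]
    _ ≤ c := ha

theorem exists_map_eq_norm_le_norm_map (φ : A →⋆ₙₐ[ℂ] B) (a : A) :
    ∃ b : A, φ b = φ a ∧ ‖b‖ ≤ ‖φ a‖ := by
  by_cases h₀ : φ a = 0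
  · exact ⟨0, by simp [h₀], by simp⟩
  have hc : 0 < ‖φ a‖ ^ 2 := by positivity
  refine ⟨a - a * cfcₙ (excess (‖φ a‖ ^ 2)) (star a * a), ?_, ?_⟩
  · rw [map_sub, map_mul, map_cfcₙ_excess_eq_zero φ hc le_rfl, mul_zero, sub_zero]
  · exact le_of_sq_le_sq (norm_sub_mul_cfcₙ_excess_sq_le hc a) (norm_nonneg _)

/-- The kernel of a `*`-homomorphism as a complex subspace, the form in which it can be divided
out as a normed space. -/
def kernel (φ : A →⋆ₙₐ[ℂ] B) : Submodule ℂ A := LinearMap.ker (φ : A →ₗ[ℂ] B)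

theorem mem_kernel (φ : A →⋆ₙₐ[ℂ] B) (a : A) : a ∈ kernel φ ↔ φ a = 0 := Iff.rfl

theorem norm_mk_kernel (φ : A →⋆ₙₐ[ℂ] B) (a : A) :
    ‖(Submodule.Quotient.mk a : A ⧸ kernel φ)‖ = ‖φ a‖ := by
  have mk_eq {b : A} (hb : φ b = φ a) :
      (Submodule.Quotient.mk b : A ⧸ kernel φ) = Submodule.Quotient.mk a := by
    rw [Submodule.Quotient.eq, mem_kernel, map_sub, hb, sub_self]
  apply le_antisymm
  · obtain ⟨b, hb, hba⟩ := exists_map_eq_norm_le_norm_map φ a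
    exact mk_eq hb ▸ (Submodule.Quotient.norm_mk_le _ b).trans hba
  · refine le_of_forall_pos_le_add fun ε hε => ?_
    obtain ⟨b, hb, hbε⟩ := Submodule.Quotient.norm_mk_lt
      (Submodule.Quotient.mk a : A ⧸ kernel φ) hε
    rw [Submodule.Quotient.eq, mem_kernel, map_sub, sub_eq_zero] at hb
    exact hb ▸ (NonUnitalStarAlgHom.norm_apply_le φ b).trans hbε.le

/-- The isometric embedding of `A ⧸ ker φ` in the codomain induced by a `*`-homomorphism `φ`. -/
def kernelLift (φ : A →⋆ₙₐ[ℂ] B) : (A ⧸ kernel φ) →ₗᵢ[ℂ] B where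
  toLinearMap := (kernel φ).liftQ (φ : A →ₗ[ℂ] B) le_rfl
  norm_map' q := by
    obtain ⟨a, rfl⟩ := Submodule.Quotient.mk_surjective _ q
    exact (norm_mk_kernel φ a).symm

theorem range_kernelLift (φ : A →⋆ₙₐ[ℂ] B) : Set.range (kernelLift φ) = Set.range φ :=
  ((Submodule.Quotient.mk_surjective (kernel φ)).range_comp (kernelLift φ)).symm

theorem isClosed_range (φ : A →⋆ₙₐ[ℂ] B) : IsClosed (Set.range φ) :=
  range_kernelLift φ ▸ (kernelLift φ).isometry.isUniformInducing.isComplete_range.isClosed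

theorem surjective_of_denseRange {φ : A →⋆ₙₐ[ℂ] B} (hφ : DenseRange φ) : Function.Surjective φ :=
  Set.range_eq_univ.1 ((isClosed_range φ).closure_eq ▸ hφ.closure_range)

/-- The first isomorphism theorem for C*-algebras, isometric for the quotient norm. -/
def quotientKernelEquiv (φ : A →⋆ₙₐ[ℂ] B) (hφ : Function.Surjective φ) :
    (A ⧸ kernel φ) ≃ₗᵢ[ℂ] B where
  toLinearEquiv := (φ : A →ₗ[ℂ] B).quotKerEquivOfSurjective hφ
  norm_map' := (kernelLift φ).norm_map

theorem quotientKernelEquiv_mk (φ : A →⋆ₙₐ[ℂ] B) (hφ : Function.Surjective φ) (a : A) :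
    quotientKernelEquiv φ hφ (Submodule.Quotient.mk a) = φ a := rfl

end CStarAlgebra

section Restriction

open scoped CStarAlgebra

variable {S : Type*} [Semigroup S] [StarMul S] [TopologicalSpace S] [ContinuousMul S]
  [ContinuousStar S] [T2Space S] [LocallyCompactSpace S] [MeasurableSpace S] [BorelSpace S]
  {ρ σ : Set (StarRep S)}

/-- The restriction of bounded families of operators from the representations in `σ` to those in
a subset `ρ`. -/
def restrictOps (h : ρ ⊆ σ) : Ops σ →⋆ₙₐ[ℂ] Ops ρ where
  toFun g := ⟨fun π => g.1 ⟨π.1, h π.2⟩, memℓp_infty ⟨‖g‖, by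
    rintro _ ⟨π, rfl⟩
    exact lp.norm_apply_le_norm ENNReal.top_ne_zero g ⟨π.1, h π.2⟩⟩⟩
  map_smul' _ _ := rfl
  map_zero' := rfl
  map_add' _ _ := rfl
  map_mul' _ _ := rfl
  map_star' _ := rfl

theorem restrictOps_family (h : ρ ⊆ σ) (μ : L S) : restrictOps h (family σ μ) = family ρ μ := rfl

theorem restrictOps_mem_topologicalClosure (h : ρ ⊆ σ) (g : CStarRho σ) :
    restrictOps h g.1 ∈ (NonUnitalStarAlgHom.range (family ρ)).topologicalClosure := by
  refine map_mem_closure (map_continuous (restrictOps h)) g.2 ?_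
  rintro _ ⟨μ, rfl⟩
  exact ⟨μ, (restrictOps_family h μ).symm⟩

/-- The canonical `*`-homomorphism `φ : C*_σ(S) → C*_ρ(S)` for `ρ ⊆ σ`. -/
def restrict (h : ρ ⊆ σ) : CStarRho σ →⋆ₙₐ[ℂ] CStarRho ρ where
  toFun g := ⟨restrictOps h g.1, restrictOps_mem_topologicalClosure h g⟩
  map_smul' _ _ := rfl
  map_zero' := rfl
  map_add' _ _ := rfl
  map_mul' _ _ := rfl
  map_star' _ := rfl

theorem restrict_toCStarRho (h : ρ ⊆ σ) (μ : L S) :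
    restrict h (toCStarRho σ μ) = toCStarRho ρ μ := rfl

theorem denseRange_restrict (h : ρ ⊆ σ) : DenseRange (restrict h) :=
  (denseRange_toCStarRho ρ).mono <| Set.range_subset_iff.2 fun μ =>
    ⟨toCStarRho σ μ, restrict_toCStarRho h μ⟩

theorem eq_restrict_of_continuous (h : ρ ⊆ σ) {ψ : CStarRho σ → CStarRho ρ} (hψ : Continuous ψ)
    (hext : ∀ μ : L S, ψ (toCStarRho σ μ) = toCStarRho ρ μ) : ψ = restrict h :=
  (denseRange_toCStarRho σ).equalizer hψ (map_continuous (restrict h)) (funext hext)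

/-- The extension of `π̃` to a `*`-representation of `C*_σ(S)`, for `π ∈ σ`. For `σ = Σ` it is
`StarRep.ext`. -/
def CStarRho.rep (π : σ) : CStarRho σ →⋆ₙₐ[ℂ] (π.1.H →L[ℂ] π.1.H) where
  toFun g := g.1.1 π
  map_smul' _ _ := rfl
  map_zero' := rfl
  map_add' _ _ := rfl
  map_mul' _ _ := rfl
  map_star' _ := rfl

/-- The common kernel `⋂_{π ∈ ρ} ker π̃` in `C*_σ(S)`, for `ρ ⊆ σ`. For `σ = Σ` it is `N'_ρ`. -/
def commonKernel (h : ρ ⊆ σ) : Submodule ℂ (CStarRho σ) :=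
  ⨅ π, ⨅ hπ : π ∈ ρ, kernel (CStarRho.rep ⟨π, h hπ⟩)

theorem commonKernel_eq_kernel_restrict (h : ρ ⊆ σ) : commonKernel h = kernel (restrict h) := by
  ext g
  simp only [commonKernel, Submodule.mem_iInf, mem_kernel]
  constructor
  · exact fun hg => Subtype.ext (lp.ext (funext fun π => hg π.1 π.2))
  · exact fun hg π hπ => congrFun (congrArg (fun f : CStarRho ρ => f.1.1) hg) ⟨π, hπ⟩

theorem toCStarRho_eq_zero_iff (μ : L S) : toCStarRho ρ μ = 0 ↔ μ ∈ N ρ := by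
  rw [← norm_eq_zero, norm_toCStarRho]
  rfl

theorem proposition2p3_general (h : ρ ⊆ σ) :
    (∀ μ ∈ N ρ, toCStarRho σ μ ∈ commonKernel h) ∧
    ∃ φ : CStarRho σ →⋆ₙₐ[ℂ] CStarRho ρ,
      (∀ μ : L S, φ (toCStarRho σ μ) = embed ρ (Submodule.Quotient.mk μ)) ∧
      Continuous φ ∧
      (∀ ψ : CStarRho σ →⋆ₙₐ[ℂ] CStarRho ρ,
        (∀ μ : L S, ψ (toCStarRho σ μ) = embed ρ (Submodule.Quotient.mk μ)) → ψ = φ) ∧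
      (∀ ψ : CStarRho σ → CStarRho ρ, Continuous ψ →
        (∀ μ : L S, ψ (toCStarRho σ μ) = embed ρ (Submodule.Quotient.mk μ)) → ψ = φ) ∧
      Function.Surjective φ ∧
      (∀ g : CStarRho σ, φ g = 0 ↔ g ∈ commonKernel h) ∧
      ∃ e : (CStarRho σ ⧸ commonKernel h) ≃ₗᵢ[ℂ] CStarRho ρ,
        ∀ g : CStarRho σ, e (Submodule.Quotient.mk g) = φ g := by
  have hsurj : Function.Surjective (restrict h) := surjective_of_denseRange (denseRange_restrict h)
  rw [commonKernel_eq_kernel_restrict h]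
  refine ⟨fun μ hμ => ?_, restrict h, restrict_toCStarRho h, map_continuous _, fun ψ hψ => ?_,
    fun ψ hψ => eq_restrict_of_continuous h hψ, hsurj, fun g => (mem_kernel _ g).symm,
    quotientKernelEquiv _ hsurj, quotientKernelEquiv_mk _ hsurj⟩
  · rwa [mem_kernel, restrict_toCStarRho, toCStarRho_eq_zero_iff]
  · exact DFunLike.coe_injective (eq_restrict_of_continuous h (map_continuous ψ) hψ)

end Restriction

end FoundationSemigroup

end

open FoundationSemigroup in
theorem proposition2p3 {S : Type*} [Semigroup S] [StarMul S] [TopologicalSpace S]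
    [ContinuousMul S] [ContinuousStar S] [T2Space S] [LocallyCompactSpace S]
    [MeasurableSpace S] [BorelSpace S] (ρ : Set (StarRep S)) :
    (∀ μ ∈ N ρ, toCStar S μ ∈ N' ρ) ∧
    ∃ φ : CStar S →⋆ₙₐ[ℂ] CStarRho ρ,
      (∀ μ : L S, φ (toCStar S μ) = embed ρ (Submodule.Quotient.mk μ)) ∧
      Continuous φ ∧
      (∀ ψ : CStar S →⋆ₙₐ[ℂ] CStarRho ρ,
        (∀ μ : L S, ψ (toCStar S μ) = embed ρ (Submodule.Quotient.mk μ)) → ψ = φ) ∧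
      (∀ ψ : CStar S → CStarRho ρ, Continuous ψ →
        (∀ μ : L S, ψ (toCStar S μ) = embed ρ (Submodule.Quotient.mk μ)) → ψ = φ) ∧
      Function.Surjective φ ∧
      (∀ g : CStar S, φ g = 0 ↔ g ∈ N' ρ) ∧
      ∃ e : (CStar S ⧸ N' ρ) ≃ₗᵢ[ℂ] CStarRho ρ,
        ∀ g : CStar S, e (Submodule.Quotient.mk g) = φ g :=
  proposition2p3_general (Set.subset_univ ρ)
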